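/- \textbf{Lemma (steady-state tracking of constant references).} Let $A\in\mathbb R^{n\times n}$, $b,c,K\in\mathbb R^n$ be such that $A_m=A-bK^\top$ is Hurwitz, put $H_o(s)=(sI-A_m)^{-1}b$, assume $c^\top H_o(0)\neq 0$, and let $k_g=1/(c^\top H_o(0))$. Let $\Omega\subset\mathbb R^n$ be compact and convex, $\theta\in\Omega$, and $\theta_{\max}=\max_{\vartheta\in\Omega}\sum_i|\vartheta_i|$. Let $C(s)$ be the transfer function of a stable strictly proper single-input single-output system, i.e. $C(s)=\int_0^\infty e^{-st}h_C(t)\,dt$ for $\operatorname{Re}s\ge 0$ with a real impulse response $h_C\in L^1(0,\infty)$ (in particular, any stable strictly proper rational function), with $C(0)=1$. Let $Q$ be symmetric positive definite, let $P$ solve $A_m^\top P+PA_m=-Q$, let $\Gamma_c>0$, $x_0\in\mathbb R^n$, $\hat\theta_0\in\Omega$. For a single-input system $H$ with $n$ outputs whose components $H_i$ have impulse responses $h_i$, put $\|H\|_{\mathcal L_1}=\max_i\int_0^\infty|h_i(t)|\,dt$. Assume the $\mathcal L_1$-gain condition $$\|\bar G\|_{\mathcal L_1}\,\theta_{\max}<1,\qquad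 \bar G(s)=H_o(s)\,(C(s)-1).$$ For a constant reference $r\in\mathbb R$, consider on $[0,\infty)$ any solution of the closed loop consisting of the plant and control law $$\dot x=Ax+b\,(u-\theta^\top x),\quad x(0)=x_0,\quad y=c^\top x,\qquad u=-K^\top x+u_2,$$ the state predictor $$\dot{\hat x}=A_m\hat x-b\,\hat\theta^\top x+b\,u_2,\qquad \hat x(0)=x_0,$$ the adaptive law $$\dot{\hat\theta}=\Gamma_c\,\mathrm{Proj}\big(\hat\theta,\;x\,(\hat x-x)^\top Pb\big),\qquad \hat\theta(0)=\hat\theta_0,$$ understood in integrated form (Carathéodory solutions), where $\mathrm{Proj}(\hat\theta,v)$ is the Euclidean nearest-point projection of $v$ onto the tangent cone of $\Omega$ at $\hat\theta$, that is, onto the closure of $\{w:\hat\theta+\varepsilon w\in\Omega\text{ for some }\varepsilon>0\}$; and $$u_2(s)=C(s)\big(\bar r(s)+k_g r(s)\big),\qquad \bar r(t)=\hat\theta^\top(t)x(t),$$ i.e. $u_2(t)=\int_0^t h_C(t-\tau)\big(\bar r(\tau)+k_g r\big)\,d\tau$. Then $$\lim_{t\to\infty}y(t)=r.$$ -/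

import Mathlib

open scoped Matrix

namespace L1Adaptive

noncomputable section

/-- A real matrix is Hurwitz if all its complex eigenvalues have negative real part. -/
def IsHurwitz {n : ℕ} (M : Matrix (Fin n) (Fin n) ℝ) : Prop :=
  ∀ z ∈ spectrum ℂ (M.map (algebraMap ℝ ℂ)), z.re < 0

/-- `h` is the (integrable) impulse response of the single-input single-output system with
transfer function `H`: the Laplace transform of `h` is `H` on the closed right half-plane.
There is no direct feedthrough term, so these are the strictly proper systems. -/
def IsImpulseResponse (h : ℝ → ℝ) (H : ℂ → ℂ) : Prop :=
  MeasureTheory.IntegrableOn h (Set.Ioi 0) ∧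
    ∀ s : ℂ, 0 ≤ s.re → ∫ t in Set.Ioi (0 : ℝ), Complex.exp (-s * t) * (h t : ℂ) = H s

/-- A stable strictly proper single-input single-output system, given by its transfer function:
it has an integrable impulse response. -/
def IsStableStrictlyProper (H : ℂ → ℂ) : Prop :=
  ∃ h : ℝ → ℝ, IsImpulseResponse h H

/-- `u(s) = H(s) v(s)`: on `[0, ∞)` the signal `u` is the response of the system `H`, with zero
initial state, to the input `v`. -/
def IsResponse (H : ℂ → ℂ) (v u : ℝ → ℝ) : Prop :=
  ∃ h : ℝ → ℝ, IsImpulseResponse h H ∧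
    ∀ t : ℝ, 0 ≤ t → u t = ∫ τ in (0 : ℝ)..t, h (t - τ) * v τ

/-- The `L₁` gain `∫₀^∞ |h(t)| dt` of a system `H` with impulse response `h`. The impulse response
is unique up to a null set, so the infimum only selects it; the value is `∞` if there is none. -/
def l1Gain (H : ℂ → ℂ) : ENNReal :=
  ⨅ (h : ℝ → ℝ) (_ : IsImpulseResponse h H), ∫⁻ t in Set.Ioi (0 : ℝ), ENNReal.ofReal |h t|

/-- The `L₁` gain of a single-input `n`-output system: the maximum over the outputs. -/
def l1GainVec {n : ℕ} (H : ℂ → Fin n → ℂ) : ENNReal :=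
  ⨆ i, l1Gain (fun s => H s i)

/-- `A_m = A - b Kᵀ`. -/
def closedMatrix {n : ℕ} (A : Matrix (Fin n) (Fin n) ℝ) (b K : Fin n → ℝ) :
    Matrix (Fin n) (Fin n) ℝ :=
  A - Matrix.vecMulVec b K

/-- `H_o(s) = (s I - A_m)⁻¹ b`, for a real (`𝕜 = ℝ`) or complex (`𝕜 = ℂ`) argument `s`. -/
def Ho (𝕜 : Type) [Field 𝕜] [Algebra ℝ 𝕜] {n : ℕ} (Am : Matrix (Fin n) (Fin n) ℝ)
    (b : Fin n → ℝ) (s : 𝕜) : Fin n → 𝕜 :=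
  (s • (1 : Matrix (Fin n) (Fin n) 𝕜) - Am.map (algebraMap ℝ 𝕜))⁻¹ *ᵥ
    (fun i => algebraMap ℝ 𝕜 (b i))

/-- `Ḡ(s) = H_o(s) (C(s) - 1)`. -/
def Gbar {n : ℕ} (Am : Matrix (Fin n) (Fin n) ℝ) (b : Fin n → ℝ) (C : ℂ → ℂ) (s : ℂ) :
    Fin n → ℂ :=
  fun i => Ho ℂ Am b s i * (C s - 1)

/-- `k_g = 1 / (cᵀ H_o(0))`. -/
def kg {n : ℕ} (Am : Matrix (Fin n) (Fin n) ℝ) (b c : Fin n → ℝ) : ℝ :=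
  1 / (c ⬝ᵥ Ho ℝ Am b 0)

/-- `θ_max = max_{θ ∈ Ω} ∑ᵢ |θᵢ|`. -/
def thetaMax {n : ℕ} (Ω : Set (Fin n → ℝ)) : ENNReal :=
  ⨆ θ ∈ Ω, ∑ i, ENNReal.ofReal |θ i|

/-- The tangent cone at `θ` of a convex set `Ω`: the closure of the cone of feasible directions. -/
def tangentCone {n : ℕ} (Ω : Set (Fin n → ℝ)) (θ : Fin n → ℝ) : Set (Fin n → ℝ) :=
  closure {v | ∃ ε : ℝ, 0 < ε ∧ θ + ε • v ∈ Ω}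

/-- The projection operator `Proj(θ, y)` of the adaptive law: the point of the tangent cone of
`Ω` at `θ` that is nearest to `y` in the Euclidean norm. In particular it is `y` itself when `θ`
is an interior point of `Ω`. -/
def Proj {n : ℕ} (Ω : Set (Fin n → ℝ)) (θ y : Fin n → ℝ) : Fin n → ℝ :=
  Classical.epsilon fun v => v ∈ tangentCone Ω θ ∧
    ∀ w ∈ tangentCone Ω θ, (y - v) ⬝ᵥ (y - v) ≤ (y - w) ⬝ᵥ (y - w)

/-- The closed-loop system on `[0, ∞)`: the plant with state `x`, input `u` and output `y`, the
control law `u = -Kᵀx + u₂`, the state predictor `x̂`, the projection-based adaptive law for `θ̂`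
(in the sense of Carathéodory, its right-hand side being discontinuous) and the control signal
`u₂(s) = C(s) (r̄(s) + k_g r(s))`, `r̄ = θ̂ᵀ x`. -/
structure IsClosedLoop {n : ℕ} (A : Matrix (Fin n) (Fin n) ℝ) (b c K : Fin n → ℝ)
    (P : Matrix (Fin n) (Fin n) ℝ) (Γc : ℝ) (C : ℂ → ℂ) (Ω : Set (Fin n → ℝ))
    (θ x₀ θhat₀ : Fin n → ℝ) (r : ℝ → ℝ)
    (x xhat θhat : ℝ → Fin n → ℝ) (u u₂ y : ℝ → ℝ) : Prop where
  plant_init : x 0 = x₀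
  plant : ∀ t : ℝ, 0 ≤ t →
    HasDerivWithinAt x (A *ᵥ x t + (u t - θ ⬝ᵥ x t) • b) (Set.Ici 0) t
  output : ∀ t : ℝ, 0 ≤ t → y t = c ⬝ᵥ x t
  control : ∀ t : ℝ, 0 ≤ t → u t = -(K ⬝ᵥ x t) + u₂ t
  predictor_init : xhat 0 = x₀
  predictor : ∀ t : ℝ, 0 ≤ t →
    HasDerivWithinAt xhat
      (closedMatrix A b K *ᵥ xhat t - (θhat t ⬝ᵥ x t) • b + u₂ t • b) (Set.Ici 0) t
  adaptation_integrable : ∀ t : ℝ, 0 ≤ t →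
    IntervalIntegrable
      (fun τ => Γc • Proj Ω (θhat τ) (((xhat τ - x τ) ⬝ᵥ (P *ᵥ b)) • x τ))
      MeasureTheory.volume 0 t
  adaptation : ∀ t : ℝ, 0 ≤ t →
    θhat t = θhat₀ +
      ∫ τ in (0 : ℝ)..t, Γc • Proj Ω (θhat τ) (((xhat τ - x τ) ⬝ᵥ (P *ᵥ b)) • x τ)
  filter : IsResponse C (fun t => θhat t ⬝ᵥ x t + kg (closedMatrix A b K) b c * r t) u₂

end

end L1Adaptive

/-! Write `x̃ = x̂ - x` for the prediction error and `h_o(t) = exp(t A_m) b`. Then `x̃' = A_m x̃ - b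
(θ̂ - θ)ᵀ x` with `x̃(0) = 0`. The projection keeps `θ̂` in `Ω` and makes the adaptive law
contribute with the right sign to the Lyapunov function `x̃ᵀ P x̃ + |θ̂ - θ|² / Γ_c`. Hence `x̃` is
bounded and square-integrable, with no prior bound on `x` (`lyapunov_le`, `error_bounds`).

By variation of constants the mismatch `(θ̂ - θ)ᵀ x` driven through `H_o` is exactly `-x̃`. Since
convolutions commute, the mismatch enters the state only as `-C x̃`, and (`state_eq`) `x = Ḡ (θᵀ x)
+ δ`, where `δ = exp(t A_m) x₀ + H_o C (k_g r) - C x̃`. The perturbation `δ` is bounded, and the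
`L₁`-gain condition makes `x ↦ Ḡ (θᵀ x)` a contraction in the sup norm, so `x` is bounded
(`bounded_of_small_gain`).

Now `x̃'` is bounded, so `x̃ → 0` by Barbalat's lemma. As `C(0) = 1`, `δ → H_o(0) k_g r` and `Ḡ(0) =
0`. Because `Ḡ` asymptotically annihilates constants, the deviation of `x` from this limit obeys the
same contraction up to vanishing terms and tends to zero (`tendsto_of_small_gain`). The value of
`k_g` turns the limit of `cᵀ x` into `r`. -/

open MeasureTheory Set Filter Topology

namespace L1Adaptive

/-! ### Causal convolution and its gains -/

/-- The response at time `t` of the kernel `h` to the input `v` switched on at time `0`. -/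
noncomputable def causalConv (h v : ℝ → ℝ) (t : ℝ) : ℝ :=
  ∫ τ in (0 : ℝ)..t, h (t - τ) * v τ

theorem causalConv_eq_swap (h v : ℝ → ℝ) (t : ℝ) :
    causalConv h v t = ∫ τ in (0 : ℝ)..t, h τ * v (t - τ) := by
  have := intervalIntegral.integral_comp_sub_left (a := 0) (b := t)
    (fun τ => h (t - τ) * v τ) t
  simp only [sub_sub_cancel, sub_self, sub_zero] at this
  rw [causalConv, this]

theorem causalConv_comm (h v : ℝ → ℝ) (t : ℝ) : causalConv h v t = causalConv v h t := by
  rw [causalConv_eq_swap, causalConv]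
  simp_rw [mul_comm]

theorem intervalIntegrable_of_integrableOn_Ioi {h : ℝ → ℝ} (hh : IntegrableOn h (Ioi 0)) {a b : ℝ}
    (ha : 0 ≤ a) (hb : 0 ≤ b) : IntervalIntegrable h volume a b := by
  rw [intervalIntegrable_iff]
  exact hh.mono_set fun x hx => lt_of_le_of_lt (le_min ha hb) hx.1

theorem intervalIntegrable_comp_sub {h : ℝ → ℝ} (hh : IntegrableOn h (Ioi 0)) {a b t : ℝ}
    (ha : a ≤ t) (hb : b ≤ t) : IntervalIntegrable (fun τ => h (t - τ)) volume a b := by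
  simpa using (intervalIntegrable_of_integrableOn_Ioi hh (sub_nonneg.2 ha)
    (sub_nonneg.2 hb)).comp_sub_left t

theorem intervalIntegrable_kernel_mul {h v : ℝ → ℝ} (hh : IntegrableOn h (Ioi 0))
    (hv : ContinuousOn v (Ici 0)) {a b t : ℝ} (h0a : 0 ≤ a) (hab : a ≤ b) (hbt : b ≤ t) :
    IntervalIntegrable (fun τ => h (t - τ) * v τ) volume a b := by
  refine (intervalIntegrable_comp_sub hh (hab.trans hbt) hbt).mul_continuousOn (hv.mono ?_)
  rw [uIcc_of_le hab]
  exact fun x hx => h0a.trans hx.1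

theorem integral_abs_le_integral_Ioi {h : ℝ → ℝ} (hh : IntegrableOn h (Ioi 0)) {t : ℝ}
    (ht : 0 ≤ t) : ∫ τ in (0 : ℝ)..t, |h τ| ≤ ∫ τ in Ioi (0 : ℝ), |h τ| := by
  rw [intervalIntegral.integral_of_le ht]
  exact setIntegral_mono_set hh.abs (Eventually.of_forall fun _ => abs_nonneg _)
    (Ioc_subset_Ioi_self.eventuallyLE)

theorem abs_integral_kernel_mul_le {h v : ℝ → ℝ} (hh : IntegrableOn h (Ioi 0)) {a b t M : ℝ}
    (hab : a ≤ b) (hbt : b ≤ t) (hM : ∀ τ ∈ Ioc a b, |v τ| ≤ M) :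
    |∫ τ in a..b, h (t - τ) * v τ| ≤ (∫ τ in (t - b)..(t - a), |h τ|) * M := by
  have hi := (intervalIntegrable_comp_sub hh (hab.trans hbt) hbt).abs.mul_const M
  have h1 : ‖∫ τ in a..b, h (t - τ) * v τ‖ ≤ ∫ τ in a..b, |h (t - τ)| * M := by
    refine intervalIntegral.norm_integral_le_of_norm_le hab ?_ hi
    refine Eventually.of_forall fun τ hτ => ?_
    rw [Real.norm_eq_abs, abs_mul]
    exact mul_le_mul_of_nonneg_left (hM τ hτ) (abs_nonneg _)
  rw [intervalIntegral.integral_mul_const,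
    intervalIntegral.integral_comp_sub_left (fun τ => |h τ|) t] at h1
  exact h1

/-- The `L₁` norm of the kernel bounds the gain from sup norm to sup norm. -/
theorem abs_causalConv_le {h v : ℝ → ℝ} (hh : IntegrableOn h (Ioi 0)) {t M : ℝ} (ht : 0 ≤ t)
    (hM0 : 0 ≤ M) (hM : ∀ τ ∈ Ioc 0 t, |v τ| ≤ M) :
    |causalConv h v t| ≤ (∫ τ in Ioi (0 : ℝ), |h τ|) * M := by
  refine (abs_integral_kernel_mul_le hh ht le_rfl hM).trans ?_
  rw [sub_self, sub_zero]
  exact mul_le_mul_of_nonneg_right (integral_abs_le_integral_Ioi hh ht) hM0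

theorem tendsto_causalConv_const {h : ℝ → ℝ} (hh : IntegrableOn h (Ioi 0)) (c : ℝ) :
    Tendsto (causalConv h fun _ => c) atTop (𝓝 ((∫ τ in Ioi (0 : ℝ), h τ) * c)) := by
  have h1 := (intervalIntegral_tendsto_integral_Ioi 0 hh tendsto_id).mul_const c
  refine h1.congr fun t => ?_
  rw [causalConv_eq_swap, intervalIntegral.integral_mul_const]
  rfl

/-- The `L₁` norm of the kernel bounds the asymptotic gain. -/
theorem eventually_abs_causalConv_le {h v : ℝ → ℝ} (hh : IntegrableOn h (Ioi 0))
    (hv : ContinuousOn v (Ici 0)) {M M' ε : ℝ} (hM : ∀ τ, 0 ≤ τ → |v τ| ≤ M) (hM0 : 0 ≤ M')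
    (hM' : ∀ᶠ τ in atTop, |v τ| ≤ M') (hε : 0 < ε) :
    ∀ᶠ t in atTop, |causalConv h v t| ≤ (∫ τ in Ioi (0 : ℝ), |h τ|) * M' + ε := by
  -- Split the convolution at `T`, beyond which the bound `M'` holds. The past part sees only the
  -- kernel on `[t - T, t]`, whose mass vanishes as `t → ∞`.
  obtain ⟨T₀, hT₀⟩ := eventually_atTop.1 hM'
  set T := max T₀ 0 with hT
  have hT0 : 0 ≤ T := le_max_right _ _
  have hlim := intervalIntegral_tendsto_integral_Ioi 0 hh.abs tendsto_id
  have htail : Tendsto (fun t => (∫ τ in (t - T)..t, |h τ|) * M) atTop (𝓝 0) := by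
    have h1 := ((hlim.sub (hlim.comp (tendsto_atTop_add_const_right atTop (-T)
      tendsto_id))).mul_const M)
    rw [sub_self, zero_mul] at h1
    refine h1.congr' ?_
    filter_upwards [eventually_ge_atTop T] with t ht
    have i1 := intervalIntegrable_of_integrableOn_Ioi hh.abs le_rfl (hT0.trans ht)
    have i2 := intervalIntegrable_of_integrableOn_Ioi hh.abs le_rfl (sub_nonneg.2 ht)
    simp only [id, Function.comp, ← sub_eq_add_neg]
    rw [intervalIntegral.integral_interval_sub_left i1 i2]
  filter_upwards [eventually_ge_atTop T, htail.eventually (gt_mem_nhds hε)] with t ht htl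
  have i1 := intervalIntegrable_kernel_mul hh hv le_rfl hT0 ht
  have i2 := intervalIntegrable_kernel_mul hh hv hT0 ht le_rfl
  rw [causalConv, ← intervalIntegral.integral_add_adjacent_intervals i1 i2]
  refine (abs_add_le _ _).trans ?_
  have b1 := abs_integral_kernel_mul_le hh hT0 ht (v := v) (M := M) fun τ hτ => hM τ hτ.1.le
  have b2 := abs_integral_kernel_mul_le hh ht le_rfl (v := v) (M := M') fun τ hτ =>
    hT₀ τ ((le_max_left _ _).trans hτ.1.le)
  rw [sub_zero] at b1
  rw [sub_self] at b2
  have b3 := mul_le_mul_of_nonneg_right (integral_abs_le_integral_Ioi hh (sub_nonneg.2 ht)) hM0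
  linarith

theorem tendsto_causalConv_zero {h v : ℝ → ℝ} (hh : IntegrableOn h (Ioi 0))
    (hv : ContinuousOn v (Ici 0)) {M : ℝ} (hM : ∀ τ, 0 ≤ τ → |v τ| ≤ M)
    (hlim : Tendsto v atTop (𝓝 0)) : Tendsto (causalConv h v) atTop (𝓝 0) := by
  have hI : 0 ≤ ∫ τ in Ioi (0 : ℝ), |h τ| := integral_nonneg fun _ => abs_nonneg _
  set I := ∫ τ in Ioi (0 : ℝ), |h τ|
  rw [Metric.tendsto_nhds]
  intro ε hε
  have hδ : 0 < ε / (2 * (I + 1)) := by positivity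
  have h1 : ∀ᶠ τ in atTop, |v τ| ≤ ε / (2 * (I + 1)) := by
    filter_upwards [(Metric.tendsto_nhds.1 hlim) _ hδ] with τ hτ
    rw [Real.dist_eq, sub_zero] at hτ
    exact hτ.le
  filter_upwards [eventually_abs_causalConv_le hh hv hM hδ.le h1 (half_pos (half_pos hε))]
    with t ht
  rw [Real.dist_eq, sub_zero]
  refine lt_of_le_of_lt ht ?_
  have : I * (ε / (2 * (I + 1))) ≤ ε / 2 := by
    rw [mul_div_assoc', div_le_div_iff₀ (by positivity) two_pos]
    nlinarith
  linarith

theorem causalConv_add {h v w : ℝ → ℝ} {t : ℝ}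
    (hv : IntervalIntegrable (fun τ => h (t - τ) * v τ) volume 0 t)
    (hw : IntervalIntegrable (fun τ => h (t - τ) * w τ) volume 0 t) :
    causalConv h (fun τ => v τ + w τ) t = causalConv h v t + causalConv h w t := by
  simp only [causalConv, mul_add]
  exact intervalIntegral.integral_add hv hw

theorem causalConv_sub {h v w : ℝ → ℝ} {t : ℝ}
    (hv : IntervalIntegrable (fun τ => h (t - τ) * v τ) volume 0 t)
    (hw : IntervalIntegrable (fun τ => h (t - τ) * w τ) volume 0 t) :
    causalConv h (fun τ => v τ - w τ) t = causalConv h v t - causalConv h w t := by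
  simp only [causalConv, mul_sub]
  exact intervalIntegral.integral_sub hv hw

theorem causalConv_neg (h v : ℝ → ℝ) (t : ℝ) :
    causalConv h (fun τ => - v τ) t = - causalConv h v t := by
  simp [causalConv]

theorem causalConv_congr {h v w : ℝ → ℝ} {t : ℝ} (ht : 0 ≤ t)
    (hvw : ∀ τ ∈ Icc 0 t, v τ = w τ) : causalConv h v t = causalConv h w t := by
  refine intervalIntegral.integral_congr fun τ hτ => ?_
  rw [uIcc_of_le ht] at hτ
  simp only [hvw τ hτ]

/-! ### Associativity of causal convolution -/

/-- By causality, truncating the input to `(0, T]` is invisible up to time `T`. The truncated input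
is integrable on the line when `v` is continuous, so whole-line convolution becomes available. -/
theorem convolution_indicator_eq_causalConv {h v : ℝ → ℝ} {s T : ℝ} (hs : 0 ≤ s) (hsT : s ≤ T) :
    convolution (indicator (Ioi 0) h) (indicator (Ioc 0 T) v) (ContinuousLinearMap.mul ℝ ℝ) volume s
      = causalConv h v s := by
  rw [causalConv_eq_swap, intervalIntegral.integral_of_le hs, integral_Ioc_eq_integral_Ioo,
    ← integral_indicator measurableSet_Ioo, convolution]
  congr 1 with τ
  by_cases hτ : τ ∈ Ioo 0 s
  · rw [indicator_of_mem hτ, indicator_of_mem (show τ ∈ Ioi 0 from hτ.1),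
      indicator_of_mem (show s - τ ∈ Ioc 0 T from ⟨by linarith [hτ.2], by linarith [hτ.1]⟩)]
    rfl
  · rw [indicator_of_notMem hτ]
    by_cases h0 : 0 < τ
    · rw [indicator_of_notMem (s := Ioc 0 T), map_zero]
      exact fun hm => hτ ⟨h0, by linarith [hm.1]⟩
    · rw [indicator_of_notMem (s := Ioi 0) (by simpa using h0), map_zero]
      rfl

theorem convolution_indicator_of_neg {h v : ℝ → ℝ} {s T : ℝ} (hs : s ≤ 0) :
    convolution (indicator (Ioi 0) h) (indicator (Ioc 0 T) v) (ContinuousLinearMap.mul ℝ ℝ) volume s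
      = 0 := by
  rw [convolution]
  refine integral_eq_zero_of_ae (Eventually.of_forall fun τ => ?_)
  by_cases h0 : 0 < τ
  · simp only [indicator_of_notMem (show s - τ ∉ Ioc 0 T from fun hm => by linarith [hm.1]),
      map_zero, Pi.zero_apply]
  · simp only [indicator_of_notMem (show τ ∉ Ioi 0 by simpa using h0), map_zero]
    rfl

theorem indicator_causalConv_eq_posConvolution (f h : ℝ → ℝ) :
    indicator (Ioi 0) (causalConv f h) =
      posConvolution f h (ContinuousLinearMap.mul ℝ ℝ) volume := by
  rw [posConvolution]
  congr 1
  ext t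
  exact causalConv_eq_swap f h t

theorem integrableOn_causalConv {f h : ℝ → ℝ} (hf : IntegrableOn f (Ioi 0))
    (hh : IntegrableOn h (Ioi 0)) : IntegrableOn (causalConv f h) (Ioi 0) := by
  rw [← integrable_indicator_iff measurableSet_Ioi, indicator_causalConv_eq_posConvolution]
  exact integrable_posConvolution hf hh _

/-- Fubini for the kernels and input extended by zero. The input is merely continuous, possibly
unbounded, so it is first cut off at `t`. -/
theorem causalConv_assoc {f h v : ℝ → ℝ} (hf : IntegrableOn f (Ioi 0))
    (hh : IntegrableOn h (Ioi 0)) (hv : ContinuousOn v (Ici 0)) {t : ℝ} (ht : 0 ≤ t) :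
    causalConv (causalConv f h) v t = causalConv f (causalConv h v) t := by
  set L := ContinuousLinearMap.mul ℝ ℝ
  set F := indicator (Ioi (0 : ℝ)) f
  set H := indicator (Ioi (0 : ℝ)) h
  set V := indicator (Ioc (0 : ℝ) t) v with hV
  have iF : Integrable F := (integrable_indicator_iff measurableSet_Ioi).2 hf
  have iH : Integrable H := (integrable_indicator_iff measurableSet_Ioi).2 hh
  have hvt : ContinuousOn v (Icc 0 t) := hv.mono Icc_subset_Ici_self
  have iV : Integrable V := (integrable_indicator_iff measurableSet_Ioc).2
    ((hvt.integrableOn_Icc).mono_set Ioc_subset_Icc_self)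
  obtain ⟨M, hM⟩ := isCompact_Icc.exists_bound_of_continuousOn hvt
  have hM0 : 0 ≤ M := (norm_nonneg _).trans (hM 0 ⟨le_rfl, ht⟩)
  have bV : ∀ s, ‖V s‖ ≤ M := fun s => by
    by_cases hs : s ∈ Ioc 0 t
    · rw [hV, indicator_of_mem hs]
      exact hM s (Ioc_subset_Icc_self hs)
    · rw [hV, indicator_of_notMem hs, norm_zero]
      exact hM0
  have key : convolution (convolution F H L volume) V L volume t
      = convolution F (convolution H V L volume) L volume t := by
    refine convolution_assoc' (L := L) (L₂ := L) (L₃ := L) (L₄ := L)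
      (fun a b c => mul_assoc a b c)
      (iF.ae_convolution_exists L iH) (iH.ae_convolution_exists L iV) ?_
    have h1 := iF.convolution_integrand L iH
    -- The truncated input is bounded, so the triple integrand inherits integrability from that of
    -- `F` convolved with `H`.
    have h2 : Integrable (fun p : ℝ × ℝ => V (t - p.1) * L (F p.2) (H (p.1 - p.2)))
        (volume.prod volume) := by
      refine h1.bdd_mul (c := M) ?_ (Eventually.of_forall fun p => bV _)
      have h3 : AEStronglyMeasurable (fun s => V (t - s)) volume :=
        (iV.comp_sub_left t).aestronglyMeasurable
      exact h3.comp_fst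
    refine h2.congr (Eventually.of_forall fun p => ?_)
    simp only [Function.uncurry, L, ContinuousLinearMap.mul_apply']
    ring
  have e1 : convolution F H L volume = indicator (Ioi 0) (causalConv f h) := by
    rw [indicator_causalConv_eq_posConvolution]
    exact (posConvolution_eq_convolution_indicator f h L volume).symm
  rw [e1, convolution_indicator_eq_causalConv ht le_rfl] at key
  rw [key, causalConv_eq_swap, intervalIntegral.integral_of_le ht, integral_Ioc_eq_integral_Ioo,
    ← integral_indicator measurableSet_Ioo, convolution]
  congr 1 with τ
  by_cases hτ : τ ∈ Ioo 0 t
  · rw [indicator_of_mem hτ, ← convolution_indicator_eq_causalConv (T := t)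
      (by linarith [hτ.2]) (by linarith [hτ.1])]
    simp only [F, indicator_of_mem (show τ ∈ Ioi 0 from hτ.1)]
    rfl
  · rw [indicator_of_notMem hτ]
    by_cases h0 : 0 < τ
    · rw [convolution_indicator_of_neg, map_zero]
      have : ¬ τ < t := fun h => hτ ⟨h0, h⟩
      linarith
    · simp only [F]
      rw [indicator_of_notMem (s := Ioi 0) (by simpa using h0), map_zero]
      rfl

/-- A bounded signal whose eventual bounds are contracted tends to zero. -/
theorem tendsto_zero_of_eventual_contraction {e : ℝ → ℝ} {lam : ℝ} (h0 : 0 ≤ lam) (h1 : lam < 1)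
    (hb : ∃ M, ∀ᶠ t in atTop, |e t| ≤ M)
    (hc : ∀ M, 0 ≤ M → (∀ᶠ t in atTop, |e t| ≤ M) → ∀ ε > 0, ∀ᶠ t in atTop, |e t| ≤ lam * M + ε) :
    Tendsto e atTop (𝓝 0) := by
  set S := {M : ℝ | 0 ≤ M ∧ ∀ᶠ t in atTop, |e t| ≤ M} with hS
  have hne : S.Nonempty := by
    obtain ⟨M, hM⟩ := hb
    obtain ⟨t, ht⟩ := hM.exists
    exact ⟨M, (abs_nonneg _).trans ht, hM⟩
  have hbd : BddBelow S := ⟨0, fun M hM => hM.1⟩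
  have hL0 : 0 ≤ sInf S := le_csInf hne fun M hM => hM.1
  have hL : sInf S = 0 := by
    by_contra hcon
    have hpos : 0 < sInf S := lt_of_le_of_ne hL0 (Ne.symm hcon)
    set L := sInf S
    -- With this `ε`, an eventual bound below `L + ε` is contracted to at most `lam * L + 2 * ε = L
    -- - 2 * ε`, contradicting that `L` is the infimum of the eventual bounds.
    set ε := (1 - lam) * L / 4
    have hε : 0 < ε := by simp only [ε]; have : 0 < 1 - lam := by linarith
                          positivity
    obtain ⟨M, hM, hML⟩ := exists_lt_of_csInf_lt hne (show sInf S < L + ε by linarith)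
    have := csInf_le hbd (show lam * M + ε ∈ S from
      ⟨by have := mul_nonneg h0 hM.1; linarith, hc M hM.1 hM.2 ε hε⟩)
    have h2 : lam * M ≤ lam * (L + ε) := mul_le_mul_of_nonneg_left hML.le h0
    have h3 : lam * ε ≤ ε := by nlinarith
    have h4 : 4 * ε = L - lam * L := by simp only [ε]; ring
    have h5 : L ≤ lam * M + ε := this
    nlinarith
  rw [Metric.tendsto_nhds]
  intro ε hε
  obtain ⟨M, hM, hMε⟩ := exists_lt_of_csInf_lt hne (show sInf S < ε by rw [hL]; exact hε)
  filter_upwards [hM.2] with t ht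
  rw [Real.dist_eq, sub_zero]
  exact lt_of_le_of_lt ht hMε

/-! ### Exponential decay of the matrix exponential -/

section MatrixExponential

attribute [local instance] Matrix.linftyOpNormedRing Matrix.linftyOpNormedAlgebra

/-- The state-transition matrix of `x' = A x`. -/
noncomputable def transition {n : ℕ} (A : Matrix (Fin n) (Fin n) ℝ) (t : ℝ) :
    Matrix (Fin n) (Fin n) ℝ :=
  NormedSpace.exp (t • A)

/-- Lets the polynomial factors from Jordan blocks be absorbed at the price of an arbitrarily small
loss of exponential rate. -/
theorem pow_mul_exp_le (k : ℕ) {a t : ℝ} (ha : 0 < a) (ht : 0 ≤ t) :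
    t ^ k / k.factorial ≤ (a⁻¹) ^ k * Real.exp (a * t) := by
  have h := Real.pow_div_factorial_le_exp (a * t) (by positivity) k
  rw [mul_pow] at h
  calc t ^ k / k.factorial = (a⁻¹) ^ k * (a ^ k * t ^ k / k.factorial) := by
        rw [mul_div_assoc, ← mul_assoc, ← mul_pow, inv_mul_cancel₀ ha.ne', one_pow, one_mul]
    _ ≤ _ := mul_le_mul_of_nonneg_left h (by positivity)

/-- `t M` is the sum of the scalar `t μ` and the commuting matrix `t (M - μ)`, and on a generalized
eigenvector the exponential series of the latter stops after `k` terms. -/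
theorem exp_smul_mulVec_of_pow_eq_zero {n : ℕ} (M : Matrix (Fin n) (Fin n) ℂ) (μ : ℂ)
    (v : Fin n → ℂ) (k : ℕ) (hk : ((M - μ • 1) ^ k) *ᵥ v = 0) (t : ℝ) :
    NormedSpace.exp (t • M) *ᵥ v =
      ∑ j ∈ Finset.range k, (Complex.exp (t * μ) * ((t ^ j / j.factorial : ℝ) : ℂ)) •
        (((M - μ • 1) ^ j) *ᵥ v) := by
  set N := M - μ • (1 : Matrix (Fin n) (Fin n) ℂ) with hN
  have h1 : t • M = algebraMap ℂ (Matrix (Fin n) (Fin n) ℂ) (t * μ) + (t : ℂ) • N := by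
    rw [hN, Algebra.algebraMap_eq_smul_one, smul_sub, smul_smul, add_sub_cancel,
      Complex.coe_smul]
  have h2 : NormedSpace.exp (algebraMap ℂ (Matrix (Fin n) (Fin n) ℂ) (t * μ))
      = algebraMap ℂ (Matrix (Fin n) (Fin n) ℂ) (NormedSpace.exp (t * μ)) :=
    (NormedSpace.algebraMap_exp_comm (𝔸 := Matrix (Fin n) (Fin n) ℂ) (t * μ : ℂ)).symm
  rw [h1, Matrix.exp_add_of_commute _ _ (Algebra.commute_algebraMap_left _ _),
    h2, Algebra.algebraMap_eq_smul_one, smul_one_mul,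
    Matrix.smul_mulVec, ← Complex.exp_eq_exp_ℂ]
  have hs := NormedSpace.exp_series_hasSum_exp' (𝕂 := ℂ) ((t : ℂ) • N)
  let L : Matrix (Fin n) (Fin n) ℂ →ₗ[ℂ] (Fin n → ℂ) :=
    { toFun := fun X => X *ᵥ v
      map_add' := fun X Y => Matrix.add_mulVec X Y v
      map_smul' := fun c X => Matrix.smul_mulVec c X v }
  have hs2 := (LinearMap.toContinuousLinearMap L).hasSum hs
  have hz : ∀ j ∉ Finset.range k,
      LinearMap.toContinuousLinearMap L (((j.factorial : ℂ)⁻¹) • ((t : ℂ) • N) ^ j) = 0 := by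
    intro j hj
    obtain ⟨m, rfl⟩ := Nat.exists_eq_add_of_le (not_lt.1 (by simpa using hj) : k ≤ j)
    change (_ • ((t : ℂ) • N) ^ (k + m)) *ᵥ v = 0
    rw [smul_pow, Matrix.smul_mulVec, Matrix.smul_mulVec, add_comm k m, pow_add N,
      ← Matrix.mulVec_mulVec, hk, Matrix.mulVec_zero, smul_zero, smul_zero]
  have hs3 := hs2.unique (hasSum_sum_of_ne_finset_zero hz)
  change NormedSpace.exp ((t : ℂ) • N) *ᵥ v = _ at hs3
  rw [hs3, Finset.smul_sum]
  refine Finset.sum_congr rfl fun j _ => ?_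
  change _ • ((_ • ((t : ℂ) • N) ^ j) *ᵥ v) = _
  rw [smul_pow, Matrix.smul_mulVec, Matrix.smul_mulVec, smul_smul, smul_smul]
  congr 1
  push_cast
  ring

/-- The vectors on which the matrix exponential of `M` decays exponentially. -/
def decaySubmodule {n : ℕ} (M : Matrix (Fin n) (Fin n) ℂ) : Submodule ℂ (Fin n → ℂ) where
  carrier := {v | ∃ C α : ℝ, 0 < α ∧ ∀ t : ℝ, 0 ≤ t →
    ‖NormedSpace.exp (t • M) *ᵥ v‖ ≤ C * Real.exp (-(α * t))}
  zero_mem' := ⟨0, 1, one_pos, fun t _ => by simp⟩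
  add_mem' := by
    rintro v w ⟨C, α, hα, hC⟩ ⟨D, β, hβ, hD⟩
    refine ⟨|C| + |D|, min α β, lt_min hα hβ, fun t ht => ?_⟩
    rw [Matrix.mulVec_add, add_mul]
    refine (norm_add_le _ _).trans (add_le_add ((hC t ht).trans ?_) ((hD t ht).trans ?_))
    · refine mul_le_mul (le_abs_self C) (Real.exp_le_exp.2 ?_) (Real.exp_pos _).le (abs_nonneg _)
      exact neg_le_neg (mul_le_mul_of_nonneg_right (min_le_left _ _) ht)
    · refine mul_le_mul (le_abs_self D) (Real.exp_le_exp.2 ?_) (Real.exp_pos _).le (abs_nonneg _)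
      exact neg_le_neg (mul_le_mul_of_nonneg_right (min_le_right _ _) ht)
  smul_mem' := by
    rintro c v ⟨C, α, hα, hC⟩
    refine ⟨‖c‖ * C, α, hα, fun t ht => ?_⟩
    rw [Matrix.mulVec_smul, norm_smul, mul_assoc]
    exact mul_le_mul_of_nonneg_left (hC t ht) (norm_nonneg _)

theorem mem_decaySubmodule_of_pow_eq_zero {n : ℕ} (M : Matrix (Fin n) (Fin n) ℂ) {μ : ℂ}
    (hμ : μ.re < 0) {v : Fin n → ℂ} {k : ℕ} (hk : ((M - μ • 1) ^ k) *ᵥ v = 0) :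
    v ∈ decaySubmodule M := by
  -- Half of the rate `-Re μ` absorbs the powers of `t`; the other half remains as decay.
  set a := -μ.re / 2 with ha
  have hapos : 0 < a := by linarith
  refine ⟨∑ j ∈ Finset.range k, (a⁻¹) ^ j * ‖((M - μ • 1) ^ j) *ᵥ v‖, a, hapos, fun t ht => ?_⟩
  rw [exp_smul_mulVec_of_pow_eq_zero M μ v k hk t, Finset.sum_mul]
  refine (norm_sum_le _ _).trans (Finset.sum_le_sum fun j _ => ?_)
  rw [norm_smul, norm_mul, Complex.norm_exp, Complex.norm_real, Real.norm_of_nonneg (by positivity)]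
  have h1 : ((t : ℂ) * μ).re = -(a * t) - a * t := by
    rw [Complex.re_ofReal_mul, ha]
    ring
  have h2 := mul_le_mul_of_nonneg_left (pow_mul_exp_le j hapos ht)
    (Real.exp_pos (-(a * t) - a * t)).le
  have h3 : Real.exp (-(a * t) - a * t) * ((a⁻¹) ^ j * Real.exp (a * t))
      = (a⁻¹) ^ j * Real.exp (-(a * t)) := by
    rw [mul_left_comm, ← Real.exp_add]
    ring_nf
  rw [h1]
  calc _ ≤ ((a⁻¹) ^ j * Real.exp (-(a * t))) * ‖((M - μ • 1) ^ j) *ᵥ v‖ :=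
        mul_le_mul_of_nonneg_right (h2.trans_eq h3) (norm_nonneg _)
    _ = _ := by ring

/-- Generalized eigenspaces span the whole space. Those for `μ` outside the spectrum are zero
because `M - μ` is invertible; the others decay. -/
theorem decaySubmodule_eq_top {n : ℕ} (M : Matrix (Fin n) (Fin n) ℂ)
    (hM : ∀ z ∈ spectrum ℂ M, z.re < 0) : decaySubmodule M = ⊤ := by
  rw [eq_top_iff, ← Module.End.iSup_maxGenEigenspace_eq_top (Matrix.toLinAlgEquiv' M)]
  refine iSup_le fun μ v hv => ?_
  obtain ⟨k, hk⟩ := (Module.End.mem_maxGenEigenspace _ _ _).1 hv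
  have hk' : ((M - μ • 1) ^ k) *ᵥ v = 0 := by
    rw [← hk, ← Matrix.toLinAlgEquiv'_apply]
    simp only [map_pow, map_sub, map_smul, map_one]
  by_cases hμ : μ ∈ spectrum ℂ M
  · exact mem_decaySubmodule_of_pow_eq_zero M (hM μ hμ) hk'
  · have hu : IsUnit (M - μ • 1) := by
      rw [spectrum.mem_iff, not_not, Algebra.algebraMap_eq_smul_one] at hμ
      rw [← neg_sub]
      exact hμ.neg
    have hv0 : v = 0 := by
      obtain ⟨X, hX⟩ := hu.pow k
      have : (↑X⁻¹ : Matrix (Fin n) (Fin n) ℂ) *ᵥ ((↑X : Matrix (Fin n) (Fin n) ℂ) *ᵥ v) = v := by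
        rw [Matrix.mulVec_mulVec, Units.inv_mul, Matrix.one_mulVec]
      rw [← this, hX, hk', Matrix.mulVec_zero]
    rw [hv0]
    exact Submodule.zero_mem _

theorem transition_zero {n : ℕ} (A : Matrix (Fin n) (Fin n) ℝ) : transition A 0 = 1 := by
  rw [transition, zero_smul, NormedSpace.exp_zero]

theorem hasDerivAt_transition_apply {n : ℕ} (A : Matrix (Fin n) (Fin n) ℝ) (t : ℝ)
    (i j : Fin n) :
    HasDerivAt (fun u => transition A u i j) ((transition A t * A) i j) t := by
  have h : HasDerivAt (transition A) (transition A t * A) t := hasDerivAt_exp_smul_const A t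
  exact ((LinearMap.toContinuousLinearMap
    (Matrix.entryLinearMap ℝ ℝ i j)).hasFDerivAt.comp_hasDerivAt t h)

theorem transition_commute {n : ℕ} (A : Matrix (Fin n) (Fin n) ℝ) (t : ℝ) :
    transition A t * A = A * transition A t :=
  ((Commute.refl A).smul_left t).exp_left

theorem isUnit_transition {n : ℕ} (A : Matrix (Fin n) (Fin n) ℝ) (t : ℝ) :
    IsUnit (transition A t) :=
  Matrix.isUnit_exp _

theorem map_transition {n : ℕ} (A : Matrix (Fin n) (Fin n) ℝ) (t : ℝ) :
    (transition A t).map (algebraMap ℝ ℂ) = NormedSpace.exp (t • A.map (algebraMap ℝ ℂ)) := by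
  let : NormedAlgebra ℚ (Matrix (Fin n) (Fin n) ℝ) := NormedAlgebra.restrictScalars ℚ ℝ _
  let : NormedAlgebra ℚ (Matrix (Fin n) (Fin n) ℂ) := NormedAlgebra.restrictScalars ℚ ℝ _
  have hc : Continuous ((algebraMap ℝ ℂ).mapMatrix : Matrix (Fin n) (Fin n) ℝ →+* _) :=
    continuous_id.matrix_map Complex.continuous_ofReal
  have h := NormedSpace.map_exp ((algebraMap ℝ ℂ).mapMatrix : Matrix (Fin n) (Fin n) ℝ →+* _) hc
    (t • A)
  rw [transition]
  refine h.trans ?_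
  congr 1
  ext i j
  simp

/-- Solutions of a Hurwitz system decay exponentially. -/
theorem exists_transition_bound {n : ℕ} {A : Matrix (Fin n) (Fin n) ℝ} (hA : IsHurwitz A)
    (v : Fin n → ℝ) :
    ∃ C α : ℝ, 0 < α ∧ ∀ t : ℝ, 0 ≤ t → ∀ i, |(transition A t *ᵥ v) i| ≤ C * Real.exp (-(α * t)) := by
  have hmem : (fun i => algebraMap ℝ ℂ (v i)) ∈ decaySubmodule (A.map (algebraMap ℝ ℂ)) := by
    rw [decaySubmodule_eq_top _ hA]
    trivial
  obtain ⟨C, α, hα, hC⟩ := hmem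
  refine ⟨C, α, hα, fun t ht i => (le_trans ?_ (norm_le_pi_norm _ i)).trans (hC t ht)⟩
  rw [← map_transition]
  have : ((transition A t).map (algebraMap ℝ ℂ) *ᵥ fun i => algebraMap ℝ ℂ (v i)) i
      = algebraMap ℝ ℂ ((transition A t *ᵥ v) i) := by
    simp [Matrix.mulVec, dotProduct]
  rw [this, Complex.coe_algebraMap, Complex.norm_real, Real.norm_eq_abs]

end MatrixExponential

/-! ### Lyapunov equation and variation of constants -/

theorem hasDerivWithinAt_dotProduct {n : ℕ} {f g : ℝ → Fin n → ℝ} {f' g' : Fin n → ℝ} {s : Set ℝ}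
    {t : ℝ} (hf : HasDerivWithinAt f f' s t) (hg : HasDerivWithinAt g g' s t) :
    HasDerivWithinAt (fun u => f u ⬝ᵥ g u) (f' ⬝ᵥ g t + f t ⬝ᵥ g') s t := by
  simp only [dotProduct, ← Finset.sum_add_distrib]
  exact HasDerivWithinAt.fun_sum fun i _ =>
    (hasDerivWithinAt_pi.1 hf i).mul (hasDerivWithinAt_pi.1 hg i)

theorem hasDerivAt_dotProduct {n : ℕ} {f g : ℝ → Fin n → ℝ} {f' g' : Fin n → ℝ}
    {t : ℝ} (hf : HasDerivAt f f' t) (hg : HasDerivAt g g' t) :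
    HasDerivAt (fun u => f u ⬝ᵥ g u) (f' ⬝ᵥ g t + f t ⬝ᵥ g') t := by
  rw [← hasDerivWithinAt_univ] at *
  exact hasDerivWithinAt_dotProduct hf hg

theorem hasDerivWithinAt_mulVec {n : ℕ} (M : Matrix (Fin n) (Fin n) ℝ) {g : ℝ → Fin n → ℝ}
    {g' : Fin n → ℝ} {s : Set ℝ} {t : ℝ} (hg : HasDerivWithinAt g g' s t) :
    HasDerivWithinAt (fun u => M *ᵥ g u) (M *ᵥ g') s t :=
  (LinearMap.toContinuousLinearMap M.mulVecLin).hasFDerivAt.comp_hasDerivWithinAt t hg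

theorem hasDerivAt_transition_mulVec {n : ℕ} (A : Matrix (Fin n) (Fin n) ℝ) (v : Fin n → ℝ)
    (t : ℝ) : HasDerivAt (fun u => transition A u *ᵥ v) (A *ᵥ (transition A t *ᵥ v)) t := by
  rw [hasDerivAt_pi]
  intro i
  have h := hasDerivAt_dotProduct (hasDerivAt_pi.2 fun j => hasDerivAt_transition_apply A t i j)
    (hasDerivAt_const t v)
  rw [dotProduct_zero, add_zero] at h
  rw [Matrix.mulVec_mulVec, ← transition_commute]
  exact h

theorem tendsto_transition_mulVec {n : ℕ} {A : Matrix (Fin n) (Fin n) ℝ} (hA : IsHurwitz A)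
    (v : Fin n → ℝ) : Tendsto (fun t => transition A t *ᵥ v) atTop (𝓝 0) := by
  rw [tendsto_pi_nhds]
  intro i
  obtain ⟨C, α, hα, hC⟩ := exists_transition_bound hA v
  have h0 : Tendsto (fun t : ℝ => C * Real.exp (-(α * t))) atTop (𝓝 0) := by
    have := (Real.tendsto_exp_neg_atTop_nhds_zero.comp
      (tendsto_id.const_mul_atTop hα)).const_mul C
    simpa using this
  refine squeeze_zero_norm' ?_ h0
  filter_upwards [eventually_ge_atTop 0] with t ht using hC t ht i

theorem integrableOn_transition_mulVec {n : ℕ} {A : Matrix (Fin n) (Fin n) ℝ} (hA : IsHurwitz A)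
    (v : Fin n → ℝ) (i : Fin n) : IntegrableOn (fun t => (transition A t *ᵥ v) i) (Ioi 0) := by
  obtain ⟨C, α, hα, hC⟩ := exists_transition_bound hA v
  have hc : Continuous fun t => (transition A t *ᵥ v) i :=
    continuous_iff_continuousAt.2 fun t =>
      (hasDerivAt_pi.1 (hasDerivAt_transition_mulVec A v t) i).continuousAt
  have hi : IntegrableOn (fun t : ℝ => C * Real.exp (-(α * t))) (Ioi 0) := by
    have h := (exp_neg_integrableOn_Ioi 0 hα).const_mul C
    simp only [neg_mul] at h
    exact h
  refine Integrable.mono' hi hc.aestronglyMeasurable ?_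
  refine (ae_restrict_mem measurableSet_Ioi).mono fun t ht => hC t (le_of_lt ht) i

/-- Along the flow a bilinear form is differentiated by the Lyapunov operator `N ↦ Aᵀ N + N A`.
Together with decay to zero at infinity this gives both the symmetry and the positivity of `P`. -/
theorem hasDerivAt_transition_bilin {n : ℕ} (A N : Matrix (Fin n) (Fin n) ℝ) (v w : Fin n → ℝ)
    (t : ℝ) :
    HasDerivAt (fun u => (transition A u *ᵥ v) ⬝ᵥ (N *ᵥ (transition A u *ᵥ w)))
      ((transition A t *ᵥ v) ⬝ᵥ ((Aᵀ * N + N * A) *ᵥ (transition A t *ᵥ w))) t := by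
  have h1 := hasDerivAt_transition_mulVec A w t
  rw [← hasDerivWithinAt_univ] at h1
  have h2 := hasDerivWithinAt_mulVec N h1
  rw [hasDerivWithinAt_univ] at h2
  refine (hasDerivAt_dotProduct (hasDerivAt_transition_mulVec A v t) h2).congr_deriv ?_
  rw [Matrix.add_mulVec, dotProduct_add, ← Matrix.mulVec_mulVec, ← Matrix.mulVec_mulVec,
    Matrix.dotProduct_mulVec _ Aᵀ, Matrix.vecMul_transpose]

theorem tendsto_transition_bilin {n : ℕ} {A : Matrix (Fin n) (Fin n) ℝ} (hA : IsHurwitz A)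
    (N : Matrix (Fin n) (Fin n) ℝ) (v w : Fin n → ℝ) :
    Tendsto (fun u => (transition A u *ᵥ v) ⬝ᵥ (N *ᵥ (transition A u *ᵥ w))) atTop (𝓝 0) := by
  have hc : Continuous fun p : (Fin n → ℝ) × (Fin n → ℝ) => p.1 ⬝ᵥ (N *ᵥ p.2) := by
    fun_prop
  have h := (hc.tendsto (0, 0)).comp
    ((tendsto_transition_mulVec hA v).prodMk_nhds (tendsto_transition_mulVec hA w))
  simp only [Matrix.mulVec_zero, dotProduct_zero] at h
  exact h

/-- The Lyapunov equation of a Hurwitz matrix has only symmetric solutions for symmetric data. -/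
theorem transpose_eq_of_lyapunov {n : ℕ} {A P Q : Matrix (Fin n) (Fin n) ℝ} (hA : IsHurwitz A)
    (hQ : Qᵀ = Q) (hP : Aᵀ * P + P * A = -Q) : Pᵀ = P := by
  -- Transposing the equation shows that `Pᵀ - P` solves the homogeneous one, so its form is
  -- constant along the flow, with limit zero.
  have hD : Aᵀ * (Pᵀ - P) + (Pᵀ - P) * A = 0 := by
    have h := congrArg Matrix.transpose hP
    rw [Matrix.transpose_add, Matrix.transpose_mul, Matrix.transpose_mul, Matrix.transpose_transpose,
      Matrix.transpose_neg, hQ, ← hP] at h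
    rw [Matrix.mul_sub, Matrix.sub_mul]
    linear_combination (norm := abel) h
  have hz : ∀ v w : Fin n → ℝ, v ⬝ᵥ ((Pᵀ - P) *ᵥ w) = 0 := by
    intro v w
    have hder : ∀ t, HasDerivAt
        (fun u => (transition A u *ᵥ v) ⬝ᵥ ((Pᵀ - P) *ᵥ (transition A u *ᵥ w))) 0 t := fun t => by
      have := hasDerivAt_transition_bilin A (Pᵀ - P) v w t
      rwa [hD, Matrix.zero_mulVec, dotProduct_zero] at this
    have hconst := is_const_of_deriv_eq_zero (fun t => (hder t).differentiableAt)
      (fun t => (hder t).deriv)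
    have h1 := tendsto_nhds_unique (tendsto_transition_bilin hA (Pᵀ - P) v w)
      (tendsto_const_nhds.congr fun t => hconst 0 t)
    simpa only [transition_zero, Matrix.one_mulVec] using h1.symm
  rw [← sub_eq_zero]
  ext i j
  simpa using hz (Pi.single i 1) (Pi.single j 1)

/-- A solution of the Lyapunov equation of a Hurwitz matrix is positive definite. -/
theorem lyapunov_pos {n : ℕ} {A P Q : Matrix (Fin n) (Fin n) ℝ} (hA : IsHurwitz A)
    (hQ : ∀ v : Fin n → ℝ, v ≠ 0 → 0 < v ⬝ᵥ (Q *ᵥ v)) (hP : Aᵀ * P + P * A = -Q)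
    {v : Fin n → ℝ} (hv : v ≠ 0) : 0 < v ⬝ᵥ (P *ᵥ v) := by
  have hne : ∀ t, transition A t *ᵥ v ≠ 0 := fun t h => hv <| by
    obtain ⟨X, hX⟩ := isUnit_transition A t
    have : (↑X⁻¹ : Matrix (Fin n) (Fin n) ℝ) *ᵥ ((↑X : Matrix (Fin n) (Fin n) ℝ) *ᵥ v) = v := by
      rw [Matrix.mulVec_mulVec, Units.inv_mul, Matrix.one_mulVec]
    rw [← this, hX, h, Matrix.mulVec_zero]
  -- The form of `P` strictly decreases along the trajectory towards the limit zero, so it starts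
  -- positive.
  have hanti := strictAnti_of_deriv_neg
    (f := fun u => (transition A u *ᵥ v) ⬝ᵥ (P *ᵥ (transition A u *ᵥ v))) fun t => by
      rw [(hasDerivAt_transition_bilin A P v v t).deriv, hP, Matrix.neg_mulVec, dotProduct_neg,
        neg_lt_zero]
      exact hQ _ (hne t)
  have h1 := hanti one_pos
  have h2 := hanti.antitone.le_of_tendsto (tendsto_transition_bilin hA P v v) 1
  simp only [transition_zero, Matrix.one_mulVec] at h1
  exact h2.trans_lt h1

theorem exists_pos_mul_norm_sq_le {n : ℕ} {P : Matrix (Fin n) (Fin n) ℝ}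
    (hP : ∀ v : Fin n → ℝ, v ≠ 0 → 0 < v ⬝ᵥ (P *ᵥ v)) :
    ∃ κ > 0, ∀ v : Fin n → ℝ, κ * ‖v‖ ^ 2 ≤ v ⬝ᵥ (P *ᵥ v) := by
  have hc : Continuous fun v : Fin n → ℝ => v ⬝ᵥ (P *ᵥ v) := by fun_prop
  have key : ∃ κ > 0, ∀ v ∈ Metric.sphere (0 : Fin n → ℝ) 1, κ ≤ v ⬝ᵥ (P *ᵥ v) := by
    -- The unit sphere is empty when `n = 0`; any constant then works.
    rcases (Metric.sphere (0 : Fin n → ℝ) 1).eq_empty_or_nonempty with h | h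
    · exact ⟨1, one_pos, by simp [h]⟩
    · obtain ⟨w, hw, hmin⟩ := (isCompact_sphere (0 : Fin n → ℝ) 1).exists_isMinOn h hc.continuousOn
      refine ⟨_, hP w ?_, fun v hv => hmin hv⟩
      rintro rfl
      simp at hw
  obtain ⟨κ, hκ, hmin⟩ := key
  refine ⟨κ, hκ, fun v => ?_⟩
  rcases eq_or_ne v 0 with rfl | hv
  · simp
  have hn : 0 < ‖v‖ := norm_pos_iff.2 hv
  have h := hmin (‖v‖⁻¹ • v) (by simp [norm_smul, hn.ne'])
  rw [Matrix.mulVec_smul, smul_dotProduct, dotProduct_smul, smul_eq_mul, smul_eq_mul] at h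
  calc κ * ‖v‖ ^ 2 ≤ (‖v‖⁻¹ * (‖v‖⁻¹ * v ⬝ᵥ (P *ᵥ v))) * ‖v‖ ^ 2 :=
        mul_le_mul_of_nonneg_right h (by positivity)
    _ = _ := by field_simp

/-- Variation of constants. -/
theorem variation_of_constants {n : ℕ} {A : Matrix (Fin n) (Fin n) ℝ} {b : Fin n → ℝ}
    {x : ℝ → Fin n → ℝ} {f : ℝ → ℝ}
    (hx : ∀ t, 0 ≤ t → HasDerivWithinAt x (A *ᵥ x t + f t • b) (Ici 0) t)
    {t : ℝ} (ht : 0 ≤ t) (hf : IntervalIntegrable f volume 0 t) (i : Fin n) :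
    x t i = (transition A t *ᵥ x 0) i + causalConv (fun s => (transition A s *ᵥ b) i) f t := by
  -- Row `i` of `exp((t - τ) A) x(τ)`: on differentiation the two terms with `A` cancel and only the
  -- forcing is left.
  set G : ℝ → ℝ := fun τ => (fun j => transition A (t - τ) i j) ⬝ᵥ x τ with hG
  have hE : ∀ τ, HasDerivAt (fun τ => fun j => transition A (t - τ) i j)
      (-fun j => (transition A (t - τ) * A) i j) τ := fun τ => by
    rw [hasDerivAt_pi]
    intro j
    have h1 := (hasDerivAt_transition_apply A (t - τ) i j).comp τ ((hasDerivAt_id τ).const_sub t)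
    simpa [Function.comp_def] using h1
  have hder : ∀ τ, 0 ≤ τ → HasDerivWithinAt G ((transition A (t - τ) *ᵥ b) i * f τ) (Ici 0) τ := by
    intro τ hτ
    refine (hasDerivWithinAt_dotProduct (hE τ).hasDerivWithinAt (hx τ hτ)).congr_deriv ?_
    have e1 : (fun j => (transition A (t - τ) * A) i j) ⬝ᵥ x τ
        = (fun j => transition A (t - τ) i j) ⬝ᵥ (A *ᵥ x τ) :=
      (congrFun (Matrix.mulVec_mulVec (x τ) (transition A (t - τ)) A) i).symm
    rw [neg_dotProduct, e1, dotProduct_add, dotProduct_smul, smul_eq_mul, mul_comm]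
    simp [Matrix.mulVec]
  have hEc : Continuous fun s => (transition A s *ᵥ b) i :=
    continuous_iff_continuousAt.2 fun s =>
      (hasDerivAt_pi.1 (hasDerivAt_transition_mulVec A b s) i).continuousAt
  have hint : IntervalIntegrable (fun τ => (transition A (t - τ) *ᵥ b) i * f τ) volume 0 t :=
    hf.continuousOn_mul (hEc.comp (continuous_const.sub continuous_id)).continuousOn
  have hftc := intervalIntegral.integral_eq_sub_of_hasDerivAt_of_le ht
    (fun τ hτ => ((hder τ hτ.1).continuousWithinAt).mono Icc_subset_Ici_self)
    (fun τ hτ => (hder τ hτ.1.le).hasDerivAt (Ici_mem_nhds hτ.1)) hint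
  have e0 : G 0 = (transition A t *ᵥ x 0) i := by simp [hG, Matrix.mulVec]
  have et : G t = x t i := by
    simp only [hG, sub_self, transition_zero]
    exact congrFun (Matrix.one_mulVec (x t)) i
  rw [e0, et] at hftc
  rw [causalConv, hftc]
  ring

/-! ### Impulse responses and transfer functions -/

theorem norm_exp_neg_mul_le {s : ℂ} (hs : 0 ≤ s.re) {t : ℝ} (ht : 0 ≤ t) :
    ‖Complex.exp (-s * t)‖ ≤ 1 := by
  rw [Complex.norm_exp, Real.exp_le_one_iff, Complex.re_mul_ofReal, Complex.neg_re]
  nlinarith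

theorem integrableOn_exp_mul {h : ℝ → ℝ} (hh : IntegrableOn h (Ioi 0)) {s : ℂ} (hs : 0 ≤ s.re) :
    IntegrableOn (fun t : ℝ => Complex.exp (-s * t) * (h t : ℂ)) (Ioi 0) := by
  refine Integrable.bdd_mul (c := 1) hh.ofReal ?_ ?_
  · exact (by fun_prop : Continuous fun t : ℝ => Complex.exp (-s * t)).aestronglyMeasurable
  · exact (ae_restrict_mem measurableSet_Ioi).mono fun t ht =>
      norm_exp_neg_mul_le hs (le_of_lt ht)

/-- An integrable function on the half-line whose Fourier transform vanishes is null. -/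
theorem ae_eq_zero_of_fourier_eq_zero {d : ℝ → ℝ} (hd : IntegrableOn d (Ioi 0))
    (h0 : ∀ s : ℂ, 0 ≤ s.re → ∫ t in Ioi (0 : ℝ), Complex.exp (-s * t) * (d t : ℂ) = 0) :
    d =ᵐ[volume.restrict (Ioi 0)] 0 := by
  set μ := (volume : Measure ℝ).restrict (Ioi 0)
  have hd' : Integrable d μ := hd
  have := isFiniteMeasure_withDensity_ofReal (μ := μ) hd'.2
  have := isFiniteMeasure_withDensity_ofReal (μ := μ) (f := fun t => -d t) hd'.neg.2
  have m1 : AEMeasurable (fun t => ENNReal.ofReal (d t)) μ := hd'.aemeasurable.ennreal_ofReal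
  have m2 : AEMeasurable (fun t => ENNReal.ofReal (-d t)) μ := hd'.neg.aemeasurable.ennreal_ofReal
  -- The positive and negative parts of `d` are densities of finite measures. The transform vanishes
  -- on the imaginary axis, so these measures have the same characteristic function and coincide.
  have key : μ.withDensity (fun t => ENNReal.ofReal (d t))
      = μ.withDensity (fun t => ENNReal.ofReal (-d t)) := by
    refine Measure.ext_of_charFun (funext fun ω => ?_)
    rw [charFun_apply_real, charFun_apply_real,
      integral_withDensity_eq_integral_toReal_smul₀ m1 (by simp),
      integral_withDensity_eq_integral_toReal_smul₀ m2 (by simp), ← sub_eq_zero]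
    have bi : ∀ f : ℝ → ℝ, Integrable f μ →
        Integrable (fun t => f t • Complex.exp (ω * t * Complex.I)) μ := fun f hf => by
      have h1 := integrableOn_exp_mul (h := f) hf (s := -(ω * Complex.I)) (by simp)
      refine Integrable.congr h1 (Eventually.of_forall fun t => ?_)
      simp only [Complex.real_smul]
      rw [mul_comm]
      ring_nf
    have i1 := bi (fun t => (ENNReal.ofReal (d t)).toReal)
      (by simpa only [ENNReal.toReal_ofReal'] using hd'.pos_part)
    have i2 := bi (fun t => (ENNReal.ofReal (-d t)).toReal)
      (by simpa only [ENNReal.toReal_ofReal'] using hd'.neg_part)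
    rw [← integral_sub i1 i2, ← h0 (-(ω * Complex.I)) (by simp)]
    refine integral_congr_ae (Eventually.of_forall fun t => ?_)
    simp only [ENNReal.toReal_ofReal']
    rw [← sub_smul, max_zero_sub_max_neg_zero_eq_self, Complex.real_smul, mul_comm]
    ring_nf
  have hfin : ∫⁻ t, ENNReal.ofReal (d t) ∂μ ≠ ⊤ := hd'.lintegral_lt_top.ne
  have hae := (withDensity_eq_iff m1 m2 hfin).1 key
  filter_upwards [hae] with t ht
  rcases le_total 0 (d t) with h | h
  · rw [ENNReal.ofReal_of_nonpos (neg_nonpos.2 h), ENNReal.ofReal_eq_zero] at ht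
    exact le_antisymm ht h
  · rw [ENNReal.ofReal_of_nonpos h, eq_comm, ENNReal.ofReal_eq_zero] at ht
    exact le_antisymm h (neg_nonpos.1 ht)

namespace IsImpulseResponse

theorem sub {h₁ h₂ : ℝ → ℝ} {H₁ H₂ : ℂ → ℂ} (h1 : IsImpulseResponse h₁ H₁)
    (h2 : IsImpulseResponse h₂ H₂) :
    IsImpulseResponse (fun t => h₁ t - h₂ t) (fun s => H₁ s - H₂ s) := by
  refine ⟨h1.1.sub h2.1, fun s hs => ?_⟩
  beta_reduce
  rw [← h1.2 s hs, ← h2.2 s hs,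
    ← integral_sub (integrableOn_exp_mul h1.1 hs) (integrableOn_exp_mul h2.1 hs)]
  simp only [Complex.ofReal_sub, mul_sub]

/-- The impulse response is determined by the transfer function. -/
theorem ae_eq {h₁ h₂ : ℝ → ℝ} {H : ℂ → ℂ} (h1 : IsImpulseResponse h₁ H)
    (h2 : IsImpulseResponse h₂ H) : h₁ =ᵐ[volume.restrict (Ioi 0)] h₂ := by
  have h := h1.sub h2
  filter_upwards [ae_eq_zero_of_fourier_eq_zero h.1 fun s hs => (h.2 s hs).trans (sub_self _)]
    with t ht using sub_eq_zero.1 ht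

theorem ofReal_integral {h : ℝ → ℝ} {H : ℂ → ℂ} (hh : IsImpulseResponse h H) :
    ((∫ t in Ioi (0 : ℝ), h t : ℝ) : ℂ) = H 0 := by
  rw [← hh.2 0 le_rfl, ← integral_complex_ofReal]
  simp

/-- The series connection of two systems. -/
theorem causalConv {f h : ℝ → ℝ} {F H : ℂ → ℂ} (hf : IsImpulseResponse f F)
    (hh : IsImpulseResponse h H) :
    IsImpulseResponse (causalConv f h) (fun s => F s * H s) := by
  refine ⟨integrableOn_causalConv hf.1 hh.1, fun s hs => ?_⟩
  -- The weight `exp(-s t)` is multiplicative in `t`, so weighting a convolution is the same as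
  -- convolving the weighted kernels.
  have key := integral_posConvolution (integrableOn_exp_mul hf.1 hs) (integrableOn_exp_mul hh.1 hs)
    (ContinuousLinearMap.mul ℝ ℂ)
  rw [hf.2 s hs, hh.2 s hs, ContinuousLinearMap.mul_apply'] at key
  beta_reduce
  rw [← key]
  refine setIntegral_congr_fun measurableSet_Ioi fun t _ => ?_
  simp only [ContinuousLinearMap.mul_apply']
  rw [causalConv_eq_swap, ← intervalIntegral.integral_ofReal,
    ← intervalIntegral.integral_const_mul]
  refine intervalIntegral.integral_congr fun τ _ => ?_
  have : Complex.exp (-s * t) = Complex.exp (-s * τ) * Complex.exp (-s * (t - τ : ℝ)) := by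
    rw [← Complex.exp_add]
    push_cast
    ring_nf
  rw [this]
  push_cast
  ring_nf

/-- Any two impulse responses agree almost everywhere, so every competitor in the infimum gives the
same integral. This turns the abstract gain into a bound on a concrete kernel. -/
theorem ofReal_integral_abs_le_l1Gain {h : ℝ → ℝ} {H : ℂ → ℂ} (hh : IsImpulseResponse h H) :
    ENNReal.ofReal (∫ t in Ioi (0 : ℝ), |h t|) ≤ l1Gain H := by
  refine le_iInf₂ fun g hg => ?_
  rw [ofReal_integral_eq_lintegral_ofReal hh.1.abs (Eventually.of_forall fun _ => abs_nonneg _)]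
  refine le_of_eq (lintegral_congr_ae ?_)
  filter_upwards [hh.ae_eq hg] with t ht
  rw [ht]

end IsImpulseResponse

theorem isUnit_resolvent {n : ℕ} {A : Matrix (Fin n) (Fin n) ℝ} (hA : IsHurwitz A) {s : ℂ}
    (hs : 0 ≤ s.re) :
    IsUnit (s • (1 : Matrix (Fin n) (Fin n) ℂ) - A.map (algebraMap ℝ ℂ)) := by
  have h : s ∉ spectrum ℂ (A.map (algebraMap ℝ ℂ)) := fun h => absurd (hA s h) (not_lt.2 hs)
  rwa [spectrum.mem_iff, not_not, Algebra.algebraMap_eq_smul_one] at h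

/-- The impulse response of `H_o(s) = (s I - A)⁻¹ b` is `exp (t A) b`. -/
theorem isImpulseResponse_Ho {n : ℕ} {A : Matrix (Fin n) (Fin n) ℝ} (hA : IsHurwitz A)
    (b : Fin n → ℝ) (i : Fin n) :
    IsImpulseResponse (fun t => (transition A t *ᵥ b) i) (fun s => Ho ℂ A b s i) := by
  have hI := integrableOn_transition_mulVec hA b
  refine ⟨hI i, fun s hs => ?_⟩
  set φ : ℝ → Fin n → ℝ := fun t => transition A t *ᵥ b with hφ
  set L : Fin n → ℂ := fun j => ∫ t in Ioi (0 : ℝ), Complex.exp (-s * t) * (φ t j : ℂ) with hL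
  have hIe : ∀ j, IntegrableOn (fun t : ℝ => Complex.exp (-s * t) * (φ t j : ℂ)) (Ioi 0) :=
    fun j => integrableOn_exp_mul (hI j) hs
  -- Integrating the derivative of `exp(-s t) φ(t)` over the half-line leaves only the boundary
  -- value at `0`, which is `b`; this is the resolvent equation for the transform.
  have key : (s • (1 : Matrix (Fin n) (Fin n) ℂ) - A.map (algebraMap ℝ ℂ)) *ᵥ L
      = fun j => algebraMap ℝ ℂ (b j) := by
    ext j
    have hd : ∀ t : ℝ, HasDerivAt (fun t : ℝ => Complex.exp (-s * t) * (φ t j : ℂ))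
        (∑ k, (A j k : ℂ) * (Complex.exp (-s * t) * (φ t k : ℂ))
          - s * (Complex.exp (-s * t) * (φ t j : ℂ))) t := by
      intro t
      have h1 : HasDerivAt (fun t : ℝ => Complex.exp (-s * t)) (Complex.exp (-s * t) * (-s)) t := by
        have := ((hasDerivAt_id (t : ℂ)).const_mul (-s)).cexp.comp_ofReal
        simpa using this
      have h2 := (hasDerivAt_pi.1 (hasDerivAt_transition_mulVec A b t) j).ofReal_comp
      refine (h1.mul h2).congr_deriv ?_
      simp only [Matrix.mulVec, dotProduct, hφ, Complex.ofReal_sum, Complex.ofReal_mul,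
        Finset.mul_sum]
      rw [add_comm, sub_eq_add_neg]
      congr 1
      · exact Finset.sum_congr rfl fun k _ => by ring_nf
      · rw [← Finset.sum_neg_distrib]
        exact Finset.sum_congr rfl fun k _ => by ring
    have hint : IntegrableOn (fun t : ℝ => ∑ k, (A j k : ℂ) * (Complex.exp (-s * t) * (φ t k : ℂ))
        - s * (Complex.exp (-s * t) * (φ t j : ℂ))) (Ioi 0) :=
      (integrable_finsetSum _ fun k _ => (hIe k).const_mul _).sub ((hIe j).const_mul _)
    have hlim : Tendsto (fun t : ℝ => Complex.exp (-s * t) * (φ t j : ℂ)) atTop (𝓝 0) := by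
      have h1 := ((tendsto_pi_nhds.1 (tendsto_transition_mulVec hA b) j).norm)
      simp only [Pi.zero_apply, norm_zero] at h1
      refine squeeze_zero_norm' ?_ h1
      filter_upwards [eventually_ge_atTop 0] with t ht
      rw [norm_mul, Complex.norm_real]
      exact mul_le_of_le_one_left (norm_nonneg _) (norm_exp_neg_mul_le hs ht)
    have hftc := integral_Ioi_of_hasDerivAt_of_tendsto
      (hd 0).continuousAt.continuousWithinAt (fun t _ => hd t) hint hlim
    rw [integral_sub (integrable_finsetSum _ fun k _ => (hIe k).const_mul _)
      ((hIe j).const_mul _), integral_finsetSum _ (fun k _ => (hIe k).const_mul _)] at hftc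
    simp only [integral_const_mul] at hftc
    have e0 : φ 0 j = b j := by simp [hφ, transition_zero]
    rw [e0] at hftc
    simp only [Complex.ofReal_zero, mul_zero, Complex.exp_zero, one_mul, zero_sub] at hftc
    rw [Matrix.sub_mulVec, Matrix.smul_mulVec, Matrix.one_mulVec]
    simp only [Pi.sub_apply, Pi.smul_apply, smul_eq_mul, Matrix.mulVec, dotProduct,
      Matrix.map_apply, Complex.coe_algebraMap, hL]
    linear_combination -hftc
  have hdet := (Matrix.isUnit_iff_isUnit_det _).1 (isUnit_resolvent hA hs)
  change L i = Ho ℂ A b s i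
  rw [Ho, ← key, Matrix.mulVec_mulVec, Matrix.nonsing_inv_mul _ hdet, Matrix.one_mulVec]

/-- Reconciles the complex DC gain of the impulse response with the real `H_o(0)` that enters `k_g`.
-/
theorem Ho_complex_zero {n : ℕ} {A : Matrix (Fin n) (Fin n) ℝ} (hA : IsHurwitz A)
    (b : Fin n → ℝ) (i : Fin n) : Ho ℂ A b 0 i = (Ho ℝ A b 0 i : ℂ) := by
  set B : Matrix (Fin n) (Fin n) ℝ := (0 : ℝ) • 1 - A.map (algebraMap ℝ ℝ) with hB
  have hmap : (0 : ℂ) • (1 : Matrix (Fin n) (Fin n) ℂ) - A.map (algebraMap ℝ ℂ)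
      = (algebraMap ℝ ℂ).mapMatrix B := by
    ext j k
    simp [hB]
  have hu := (Matrix.isUnit_iff_isUnit_det _).1 (isUnit_resolvent hA (s := 0) le_rfl)
  rw [hmap, ← RingHom.map_det, isUnit_iff_ne_zero, _root_.map_ne_zero, ← isUnit_iff_ne_zero] at hu
  have hinv : ((algebraMap ℝ ℂ).mapMatrix B)⁻¹ = (algebraMap ℝ ℂ).mapMatrix B⁻¹ := by
    refine Matrix.inv_eq_left_inv ?_
    rw [← map_mul, Matrix.nonsing_inv_mul _ hu, map_one]
  rw [Ho, Ho, hmap, hinv]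
  simp [Matrix.mulVec, dotProduct, hB]

/-- The scalar form of the gain condition used by the small-gain argument: the one-norm of `θ` is
what bounds `θᵀ x` by the sup norm of `x`. -/
theorem integral_abs_mul_sum_lt_one {n : ℕ} {G : ℂ → Fin n → ℂ} {g : Fin n → ℝ → ℝ}
    {Ω : Set (Fin n → ℝ)} (hg : ∀ i, IsImpulseResponse (g i) (fun s => G s i))
    (hgain : l1GainVec G * thetaMax Ω < 1) {θ : Fin n → ℝ} (hθ : θ ∈ Ω) (i : Fin n) :
    (∫ t in Ioi (0 : ℝ), |g i t|) * ∑ j, |θ j| < 1 := by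
  have h1 : ENNReal.ofReal (∫ t in Ioi (0 : ℝ), |g i t|) ≤ l1GainVec G :=
    (hg i).ofReal_integral_abs_le_l1Gain.trans (le_iSup (fun i => l1Gain fun s => G s i) i)
  have h2 : ENNReal.ofReal (∑ j, |θ j|) ≤ thetaMax Ω := by
    rw [ENNReal.ofReal_sum_of_nonneg fun _ _ => abs_nonneg _]
    exact le_iSup₂ (f := fun (θ : Fin n → ℝ) (_ : θ ∈ Ω) => ∑ i, ENNReal.ofReal |θ i|) θ hθ
  have h3 := (mul_le_mul' h1 h2).trans_lt hgain
  rw [← ENNReal.ofReal_mul (integral_nonneg fun _ => abs_nonneg _), ENNReal.ofReal_lt_one] at h3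
  exact h3

/-! ### Projection onto the tangent cone -/

section Projection

variable {n : ℕ} {Ω : Set (Fin n → ℝ)}

theorem sub_mem_tangentCone {ϑ ω : Fin n → ℝ} (hω : ω ∈ Ω) : ω - ϑ ∈ tangentCone Ω ϑ :=
  subset_closure ⟨1, one_pos, by simpa using hω⟩

theorem add_mem_tangentCone (hΩc : Convex ℝ Ω) {ϑ v w : Fin n → ℝ} (hv : v ∈ tangentCone Ω ϑ)
    (hw : w ∈ tangentCone Ω ϑ) : v + w ∈ tangentCone Ω ϑ := by
  refine map_mem_closure₂ (f := fun v w => v + w) continuous_add hv hw ?_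
  rintro a ⟨ε, hε, ha⟩ c ⟨δ, hδ, hc⟩
  -- This step length makes the new point the convex combination of `ϑ + ε a` and `ϑ + δ c` with
  -- weights `δ / (ε + δ)` and `ε / (ε + δ)`.
  refine ⟨ε * δ / (ε + δ), by positivity, ?_⟩
  have h := hΩc ha hc (show 0 ≤ δ / (ε + δ) by positivity) (show 0 ≤ ε / (ε + δ) by positivity)
    (by field_simp; ring)
  convert h using 1
  ext i
  simp only [Pi.add_apply, Pi.smul_apply, smul_eq_mul]
  field_simp
  ring

theorem smul_mem_tangentCone {ϑ v : Fin n → ℝ} {s : ℝ} (hs : 0 < s)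
    (hv : v ∈ tangentCone Ω ϑ) : s • v ∈ tangentCone Ω ϑ := by
  refine map_mem_closure (continuous_const_smul s) hv ?_
  rintro a ⟨ε, hε, ha⟩
  refine ⟨ε / s, by positivity, ?_⟩
  rw [smul_smul, div_mul_cancel₀ _ hs.ne']
  exact ha

theorem norm_sq_le_dotProduct_self (v : Fin n → ℝ) : ‖v‖ ^ 2 ≤ v ⬝ᵥ v := by
  have h0 : 0 ≤ v ⬝ᵥ v := Finset.sum_nonneg fun i _ => mul_self_nonneg _
  have h : ‖v‖ ≤ √(v ⬝ᵥ v) := by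
    refine (pi_norm_le_iff_of_nonneg (Real.sqrt_nonneg _)).2 fun i => Real.abs_le_sqrt ?_
    rw [sq]
    exact Finset.single_le_sum (f := fun i => v i * v i) (fun i _ => mul_self_nonneg _)
      (Finset.mem_univ i)
  exact (Real.le_sqrt (norm_nonneg _) h0).1 h

/-- `Proj` is a bare choice, so a nearest point must be shown to exist: the cone is closed and
contains `ω - ϑ`, and the distance to `y` is coercive. -/
theorem Proj_spec (hΩ : Ω.Nonempty) (ϑ y : Fin n → ℝ) :
    Proj Ω ϑ y ∈ tangentCone Ω ϑ ∧ ∀ w ∈ tangentCone Ω ϑ,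
      (y - Proj Ω ϑ y) ⬝ᵥ (y - Proj Ω ϑ y) ≤ (y - w) ⬝ᵥ (y - w) := by
  refine Classical.epsilon_spec (p := fun v => v ∈ tangentCone Ω ϑ ∧
    ∀ w ∈ tangentCone Ω ϑ, (y - v) ⬝ᵥ (y - v) ≤ (y - w) ⬝ᵥ (y - w)) ?_
  obtain ⟨ω, hω⟩ := hΩ
  set f : (Fin n → ℝ) → ℝ := fun w => (y - w) ⬝ᵥ (y - w) with hf
  have hfc : Continuous f := by fun_prop
  have hev : ∀ᶠ w in cocompact (Fin n → ℝ) ⊓ 𝓟 (tangentCone Ω ϑ), f (ω - ϑ) ≤ f w := by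
    refine Filter.Eventually.filter_mono inf_le_left ?_
    have h0 : 0 ≤ f (ω - ϑ) := Finset.sum_nonneg fun i _ => mul_self_nonneg _
    filter_upwards [tendsto_norm_cocompact_atTop.eventually_ge_atTop (‖y‖ + f (ω - ϑ) + 1)]
      with w hw
    have h1 : f (ω - ϑ) + 1 ≤ ‖y - w‖ := by
      have := norm_sub_norm_le w y
      rw [norm_sub_rev] at this
      linarith
    have h2 := norm_sq_le_dotProduct_self (y - w)
    have h3 : f w = (y - w) ⬝ᵥ (y - w) := rfl
    nlinarith
  obtain ⟨v, hv, hmin⟩ := hfc.continuousOn.exists_isMinOn' isClosed_closure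
    (sub_mem_tangentCone (ϑ := ϑ) hω) hev
  exact ⟨v, hv, fun w hw => hmin hw⟩

theorem nonpos_of_forall_quadratic {a c : ℝ} (hc : 0 ≤ c)
    (h : ∀ s > 0, 2 * s * a ≤ s ^ 2 * c) : a ≤ 0 := by
  by_contra ha
  have ha : 0 < a := not_le.1 ha
  -- For `s = a / (c + 1)` the hypothesis would give `2 s a ≤ s² c ≤ s² (c + 1) = s a`.
  have hs : 0 < a / (c + 1) := by positivity
  have h1 := h _ hs
  have h2 : a / (c + 1) * (c + 1) = a := by field_simp
  nlinarith

/-- The variational inequality of the projection onto the tangent cone. -/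
theorem sub_Proj_dotProduct_nonpos (hΩ : Ω.Nonempty) (hΩc : Convex ℝ Ω) (ϑ y : Fin n → ℝ)
    {w : Fin n → ℝ} (hw : w ∈ tangentCone Ω ϑ) : (y - Proj Ω ϑ y) ⬝ᵥ w ≤ 0 := by
  obtain ⟨hv, hmin⟩ := Proj_spec hΩ ϑ y
  set v := Proj Ω ϑ y
  refine nonpos_of_forall_quadratic (c := w ⬝ᵥ w)
    (Finset.sum_nonneg fun i _ => mul_self_nonneg _) fun s hs => ?_
  have h := hmin (v + s • w) (add_mem_tangentCone hΩc hv (smul_mem_tangentCone hs hw))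
  have e : (y - (v + s • w)) ⬝ᵥ (y - (v + s • w))
      = (y - v) ⬝ᵥ (y - v) - 2 * s * ((y - v) ⬝ᵥ w) + s ^ 2 * (w ⬝ᵥ w) := by
    rw [← sub_sub]
    generalize y - v = a
    simp only [sub_dotProduct, dotProduct_sub, smul_dotProduct, dotProduct_smul, smul_eq_mul,
      dotProduct_comm w a]
    ring
  linarith

/-- A curve whose velocity stays in the tangent cones of a compact convex set never leaves it. -/
theorem mem_of_velocity_mem_tangentCone (hΩ : IsCompact Ω) (hΩc : Convex ℝ Ω) {z₀ : Fin n → ℝ}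
    (hz₀ : z₀ ∈ Ω) {z g : ℝ → Fin n → ℝ} (hg : ∀ t, 0 ≤ t → IntervalIntegrable g volume 0 t)
    (hz : ∀ t, 0 ≤ t → z t = z₀ + ∫ τ in (0 : ℝ)..t, g τ)
    (htan : ∀ t, 0 ≤ t → g t ∈ tangentCone Ω (z t)) {t : ℝ} (ht : 0 ≤ t) : z t ∈ Ω := by
  -- Separate `z t` from `Ω` by a functional `f` with threshold `u`, and take the last time `s` at
  -- which `f (z s) ≤ u`. Afterwards every feasible direction has to decrease `f`, so `f ∘ z` cannot
  -- have risen above `u`.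
  by_contra hcon
  obtain ⟨f, u, hfu, hu⟩ := geometric_hahn_banach_closed_point hΩc hΩ.isClosed hcon
  have hz0 : z 0 = z₀ := by simpa using hz 0 le_rfl
  have hcont : ContinuousOn z (Icc 0 t) := by
    have h1 := intervalIntegral.continuousOn_primitive_interval' (hg t ht) left_mem_uIcc
    rw [uIcc_of_le ht] at h1
    exact (continuousOn_const.add h1).congr fun τ hτ => hz τ hτ.1
  have hFc : ContinuousOn (fun τ => f (z τ)) (Icc 0 t) := f.continuous.comp_continuousOn hcont
  have hSc : IsCompact (Icc 0 t ∩ (fun τ => f (z τ)) ⁻¹' Iic u) :=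
    isCompact_Icc.of_isClosed_subset (hFc.preimage_isClosed_of_isClosed isClosed_Icc isClosed_Iic)
      inter_subset_left
  obtain ⟨s, ⟨⟨hs0, hst⟩, hsu⟩, hmax⟩ := hSc.exists_isGreatest
    ⟨0, ⟨le_rfl, ht⟩, by simpa only [mem_preimage, mem_Iic, hz0] using (hfu _ hz₀).le⟩
  have hgt : ∀ τ ∈ Ioc s t, f (g τ) ≤ 0 := by
    intro τ hτ
    have hτ0 : 0 ≤ τ := hs0.trans hτ.1.le
    have hτu : u < f (z τ) := by
      by_contra h
      exact absurd (hmax ⟨⟨hτ0, hτ.2⟩, not_lt.1 h⟩) (not_le.2 hτ.1)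
    refine closure_minimal (t := {v | f v ≤ 0}) ?_ (isClosed_le f.continuous continuous_const)
      (htan τ hτ0)
    rintro v ⟨ε, hε, hv⟩
    have h1 := hfu _ hv
    rw [map_add, map_smul, smul_eq_mul] at h1
    by_contra h
    have := mul_pos hε (not_le.1 h)
    linarith
  have i1 := hg t ht
  have i2 := hg s hs0
  have hint : IntervalIntegrable g volume s t := i2.symm.trans i1
  have hdiff : f (z t) - f (z s) = ∫ τ in s..t, f (g τ) := by
    rw [ContinuousLinearMap.intervalIntegral_comp_comm _ hint, ← map_sub, hz t ht, hz s hs0,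
      add_sub_add_left_eq_sub, intervalIntegral.integral_interval_sub_left i1 i2]
  have hle : ∫ τ in s..t, f (g τ) ≤ 0 := by
    rw [intervalIntegral.integral_of_le hst]
    exact setIntegral_nonpos measurableSet_Ioc hgt
  have hsu' : f (z s) ≤ u := hsu
  linarith

end Projection

/-! ### Lyapunov analysis of the adaptive loop -/

/-- The square of a primitive. -/
theorem sq_add_integral {g : ℝ → ℝ} {z₀ t : ℝ} (hg : IntervalIntegrable g volume 0 t) :
    (z₀ + ∫ τ in (0 : ℝ)..t, g τ) ^ 2
      = z₀ ^ 2 + ∫ s in (0 : ℝ)..t, 2 * ((z₀ + ∫ τ in (0 : ℝ)..s, g τ) * g s) := by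
  -- A Carathéodory solution is only absolutely continuous, so integration by parts replaces the
  -- pointwise chain rule.
  have hac : AbsolutelyContinuousOnInterval (fun s => z₀ + ∫ τ in (0 : ℝ)..s, g τ) 0 t :=
    (contDiffOn_const (c := z₀)).absolutelyContinuousOnInterval.add
      (hg.absolutelyContinuousOnInterval_intervalIntegral left_mem_uIcc)
  have h := hac.integral_deriv_mul_eq_sub hac
  have hcongr : ∫ s in (0 : ℝ)..t, 2 * ((z₀ + ∫ τ in (0 : ℝ)..s, g τ) * g s)
      = ∫ s in (0 : ℝ)..t, (deriv (fun s => z₀ + ∫ τ in (0 : ℝ)..s, g τ) s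
          * (z₀ + ∫ τ in (0 : ℝ)..s, g τ)
        + (z₀ + ∫ τ in (0 : ℝ)..s, g τ) * deriv (fun s => z₀ + ∫ τ in (0 : ℝ)..s, g τ) s) := by
    refine intervalIntegral.integral_congr_ae ?_
    filter_upwards [hg.ae_hasDerivAt_integral] with s hs hst
    rw [((hs (uIoc_subset_uIcc hst) 0 left_mem_uIcc).const_add z₀).deriv]
    ring
  rw [hcongr, h, intervalIntegral.integral_same]
  ring

namespace IsClosedLoop

variable {n : ℕ} {A : Matrix (Fin n) (Fin n) ℝ} {b c K : Fin n → ℝ}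
  {P Q : Matrix (Fin n) (Fin n) ℝ} {Γc : ℝ} {C : ℂ → ℂ} {Ω : Set (Fin n → ℝ)}
  {θ x₀ θhat₀ : Fin n → ℝ} {r : ℝ → ℝ} {x xhat θhat : ℝ → Fin n → ℝ} {u u₂ y : ℝ → ℝ}

theorem hasDerivWithinAt_state (H : IsClosedLoop A b c K P Γc C Ω θ x₀ θhat₀ r x xhat θhat u u₂ y)
    {t : ℝ} (ht : 0 ≤ t) :
    HasDerivWithinAt x (closedMatrix A b K *ᵥ x t + (u₂ t - θ ⬝ᵥ x t) • b) (Ici 0) t := by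
  refine (H.plant t ht).congr_deriv ?_
  rw [H.control t ht, closedMatrix, Matrix.sub_mulVec, Matrix.vecMulVec_mulVec]
  ext i
  simp only [Pi.add_apply, Pi.sub_apply, Pi.smul_apply, smul_eq_mul, MulOpposite.smul_eq_mul_unop,
    MulOpposite.unop_op]
  ring

theorem hasDerivWithinAt_error (H : IsClosedLoop A b c K P Γc C Ω θ x₀ θhat₀ r x xhat θhat u u₂ y)
    {t : ℝ} (ht : 0 ≤ t) :
    HasDerivWithinAt (fun t => xhat t - x t) (closedMatrix A b K *ᵥ (xhat t - x t)
      + (-((θhat t - θ) ⬝ᵥ x t)) • b) (Ici 0) t := by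
  refine ((H.predictor t ht).sub (H.hasDerivWithinAt_state ht)).congr_deriv ?_
  rw [Matrix.mulVec_sub, sub_dotProduct]
  ext i
  simp only [Pi.add_apply, Pi.sub_apply, Pi.smul_apply, smul_eq_mul]
  ring

theorem continuousOn_state (H : IsClosedLoop A b c K P Γc C Ω θ x₀ θhat₀ r x xhat θhat u u₂ y) :
    ContinuousOn x (Ici 0) :=
  fun t ht => (H.plant t ht).continuousWithinAt

theorem continuousOn_error (H : IsClosedLoop A b c K P Γc C Ω θ x₀ θhat₀ r x xhat θhat u u₂ y) :
    ContinuousOn (fun t => xhat t - x t) (Ici 0) :=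
  fun _ ht => (H.hasDerivWithinAt_error ht).continuousWithinAt

theorem continuousOn_estimate
    (H : IsClosedLoop A b c K P Γc C Ω θ x₀ θhat₀ r x xhat θhat u u₂ y) :
    ContinuousOn θhat (Ici 0) := by
  intro t ht
  have ht : 0 ≤ t := ht
  have ht1 : 0 ≤ t + 1 := by linarith
  have h1 := intervalIntegral.continuousOn_primitive_interval' (H.adaptation_integrable (t + 1) ht1)
    left_mem_uIcc
  rw [uIcc_of_le ht1] at h1
  have h2 : ContinuousOn θhat (Icc 0 (t + 1)) :=
    (continuousOn_const.add h1).congr fun τ hτ => H.adaptation τ hτ.1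
  refine (h2 t ⟨ht, by linarith⟩).mono_of_mem_nhdsWithin ?_
  rw [← Ici_inter_Iic]
  exact inter_mem_nhdsWithin _ (Iic_mem_nhds (by linarith))

theorem estimate_mem (H : IsClosedLoop A b c K P Γc C Ω θ x₀ θhat₀ r x xhat θhat u u₂ y)
    (hΓc : 0 < Γc) (hΩ : IsCompact Ω) (hΩc : Convex ℝ Ω) (hθhat₀ : θhat₀ ∈ Ω) {t : ℝ}
    (ht : 0 ≤ t) : θhat t ∈ Ω :=
  mem_of_velocity_mem_tangentCone hΩ hΩc hθhat₀ H.adaptation_integrable H.adaptation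
    (fun _ _ => smul_mem_tangentCone hΓc (Proj_spec ⟨_, hθhat₀⟩ _ _).1) ht

/-- Integrates the derivative of `x̃ᵀ P x̃`. Symmetry of `P` merges the two cross terms, and equal
initial states remove the boundary term. -/
theorem integral_error_energy
    (H : IsClosedLoop A b c K P Γc C Ω θ x₀ θhat₀ r x xhat θhat u u₂ y) (hPs : Pᵀ = P)
    (hP : (closedMatrix A b K)ᵀ * P + P * closedMatrix A b K = -Q) {t : ℝ} (ht : 0 ≤ t) :
    (xhat t - x t) ⬝ᵥ (P *ᵥ (xhat t - x t)) + ∫ τ in (0 : ℝ)..t,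
      (xhat τ - x τ) ⬝ᵥ (Q *ᵥ (xhat τ - x τ))
    = - ∫ τ in (0 : ℝ)..t, 2 * (((xhat τ - x τ) ⬝ᵥ (P *ᵥ b)) * ((θhat τ - θ) ⬝ᵥ x τ)) := by
  set e : ℝ → Fin n → ℝ := fun t => xhat t - x t with he
  have hec : ContinuousOn e (Icc 0 t) := H.continuousOn_error.mono Icc_subset_Ici_self
  have hxc : ContinuousOn x (Icc 0 t) := H.continuousOn_state.mono Icc_subset_Ici_self
  have hθc : ContinuousOn θhat (Icc 0 t) := H.continuousOn_estimate.mono Icc_subset_Ici_self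
  have hc2 : Continuous fun p : (Fin n → ℝ) × (Fin n → ℝ) => p.1 ⬝ᵥ p.2 := by fun_prop
  have hQc : Continuous fun v : Fin n → ℝ => v ⬝ᵥ (Q *ᵥ v) := by fun_prop
  have hPc : Continuous fun v : Fin n → ℝ => v ⬝ᵥ (P *ᵥ b) := by fun_prop
  have hder : ∀ τ, 0 ≤ τ → HasDerivWithinAt (fun τ => e τ ⬝ᵥ (P *ᵥ e τ))
      (-(e τ ⬝ᵥ (Q *ᵥ e τ)) - 2 * ((e τ ⬝ᵥ (P *ᵥ b)) * ((θhat τ - θ) ⬝ᵥ x τ))) (Ici 0) τ := by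
    intro τ hτ
    have h1 := H.hasDerivWithinAt_error hτ
    refine (hasDerivWithinAt_dotProduct h1 (hasDerivWithinAt_mulVec P h1)).congr_deriv ?_
    have e1 : (closedMatrix A b K *ᵥ e τ) ⬝ᵥ (P *ᵥ e τ) + e τ ⬝ᵥ (P *ᵥ (closedMatrix A b K *ᵥ e τ))
        = -(e τ ⬝ᵥ (Q *ᵥ e τ)) := by
      rw [← dotProduct_neg, ← Matrix.neg_mulVec, ← hP, Matrix.add_mulVec, dotProduct_add,
        ← Matrix.mulVec_mulVec, ← Matrix.mulVec_mulVec, Matrix.dotProduct_mulVec _ (closedMatrix A b K)ᵀ,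
        Matrix.vecMul_transpose]
    have e2 : b ⬝ᵥ (P *ᵥ e τ) = e τ ⬝ᵥ (P *ᵥ b) := by
      rw [Matrix.dotProduct_mulVec, ← Matrix.mulVec_transpose, hPs, dotProduct_comm]
    rw [add_dotProduct, smul_dotProduct, Matrix.mulVec_add, dotProduct_add, Matrix.mulVec_smul,
      dotProduct_smul, ← e1]
    simp only [smul_eq_mul]
    rw [show xhat τ - x τ = e τ from rfl, e2]
    ring
  have iQ : IntervalIntegrable (fun τ => e τ ⬝ᵥ (Q *ᵥ e τ)) volume 0 t := by
    refine ContinuousOn.intervalIntegrable ?_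
    rw [uIcc_of_le ht]
    exact hQc.comp_continuousOn hec
  have iη : IntervalIntegrable (fun τ => 2 * ((e τ ⬝ᵥ (P *ᵥ b)) * ((θhat τ - θ) ⬝ᵥ x τ)))
      volume 0 t := by
    refine ContinuousOn.intervalIntegrable ?_
    rw [uIcc_of_le ht]
    exact continuousOn_const.mul ((hPc.comp_continuousOn hec).mul
      (hc2.comp_continuousOn ((hθc.sub continuousOn_const).prodMk hxc)))
  have hftc := intervalIntegral.integral_eq_sub_of_hasDerivAt_of_le ht
    (fun τ hτ => ((hder τ hτ.1).continuousWithinAt).mono Icc_subset_Ici_self)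
    (fun τ hτ => (hder τ hτ.1.le).hasDerivAt (Ici_mem_nhds hτ.1)) (iQ.neg.sub iη)
  have iQn : IntervalIntegrable (fun τ => -(e τ ⬝ᵥ (Q *ᵥ e τ))) volume 0 t := iQ.neg
  rw [intervalIntegral.integral_sub iQn iη, intervalIntegral.integral_neg] at hftc
  have e0 : e 0 = 0 := by simp only [he, H.plant_init, H.predictor_init, sub_self]
  simp only [e0, zero_dotProduct, sub_zero] at hftc
  linarith

/-- Since `θ - θ̂` is a feasible direction at `θ̂`, the variational inequality shows that projecting
can only lower the growth of `|θ̂ - θ|²`. The remaining cross term is the one of opposite sign in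
the error energy. -/
theorem estimate_sub_sq_le
    (H : IsClosedLoop A b c K P Γc C Ω θ x₀ θhat₀ r x xhat θhat u u₂ y) (hΓc : 0 < Γc)
    (hΩc : Convex ℝ Ω) (hθ : θ ∈ Ω) {t : ℝ} (ht : 0 ≤ t) :
    (θhat t - θ) ⬝ᵥ (θhat t - θ) ≤ (θhat₀ - θ) ⬝ᵥ (θhat₀ - θ) + Γc * ∫ τ in (0 : ℝ)..t,
      2 * (((xhat τ - x τ) ⬝ᵥ (P *ᵥ b)) * ((θhat τ - θ) ⬝ᵥ x τ)) := by
  set g : ℝ → Fin n → ℝ :=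
    fun τ => Γc • Proj Ω (θhat τ) (((xhat τ - x τ) ⬝ᵥ (P *ᵥ b)) • x τ) with hg
  have hgi : ∀ i, IntervalIntegrable (fun τ => g τ i) volume 0 t := fun i => by
    have h := H.adaptation_integrable t ht
    exact ⟨h.1.eval i, h.2.eval i⟩
  have hcomp : ∀ i, ∀ s, 0 ≤ s → θhat s i - θ i = (θhat₀ i - θ i) + ∫ τ in (0 : ℝ)..s, g τ i := by
    intro i s hs
    have h := congrFun (H.adaptation s hs) i
    have h2 := (ContinuousLinearMap.proj (R := ℝ) (φ := fun _ : Fin n => ℝ)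
      i).intervalIntegral_comp_comm (H.adaptation_integrable s hs)
    simp only [ContinuousLinearMap.proj_apply] at h2
    rw [h, Pi.add_apply, ← h2]
    ring
  have hθc : ContinuousOn θhat (Icc 0 t) := H.continuousOn_estimate.mono Icc_subset_Ici_self
  have hsq : ∀ i, (θhat t i - θ i) ^ 2 = (θhat₀ i - θ i) ^ 2
      + ∫ s in (0 : ℝ)..t, 2 * ((θhat s i - θ i) * g s i) := by
    intro i
    rw [hcomp i t ht, sq_add_integral (hgi i)]
    congr 1
    refine intervalIntegral.integral_congr fun s hs => ?_
    rw [uIcc_of_le ht] at hs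
    simp only [hcomp i s hs.1]
  have hint : ∀ i, IntervalIntegrable (fun s => 2 * ((θhat s i - θ i) * g s i)) volume 0 t := by
    intro i
    refine ((hgi i).continuousOn_mul ?_).const_mul 2
    rw [uIcc_of_le ht]
    exact ((continuous_apply i).comp_continuousOn hθc).sub continuousOn_const
  have hsum : (θhat t - θ) ⬝ᵥ (θhat t - θ) = (θhat₀ - θ) ⬝ᵥ (θhat₀ - θ)
      + ∫ s in (0 : ℝ)..t, ∑ i, 2 * ((θhat s i - θ i) * g s i) := by
    rw [intervalIntegral.integral_finsetSum fun i _ => hint i]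
    simp only [dotProduct, Pi.sub_apply, ← sq, ← Finset.sum_add_distrib]
    exact Finset.sum_congr rfl fun i _ => hsq i
  rw [hsum, ← intervalIntegral.integral_const_mul]
  gcongr
  refine intervalIntegral.integral_mono_on ht ?_ ?_ fun s hs => ?_
  · simpa only [Finset.sum_fn] using IntervalIntegrable.sum Finset.univ fun i _ => hint i
  · refine ContinuousOn.intervalIntegrable ?_
    rw [uIcc_of_le ht]
    have hec : ContinuousOn (fun t => xhat t - x t) (Icc 0 t) :=
      H.continuousOn_error.mono Icc_subset_Ici_self
    have hxc : ContinuousOn x (Icc 0 t) := H.continuousOn_state.mono Icc_subset_Ici_self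
    have hc2 : Continuous fun p : (Fin n → ℝ) × (Fin n → ℝ) => p.1 ⬝ᵥ p.2 := by fun_prop
    exact continuousOn_const.mul (continuousOn_const.mul
      ((hc2.comp_continuousOn (hec.prodMk continuousOn_const)).mul
      (hc2.comp_continuousOn ((hθc.sub continuousOn_const).prodMk hxc))))
  · have hvar := sub_Proj_dotProduct_nonpos ⟨θ, hθ⟩ hΩc (θhat s)
      (((xhat s - x s) ⬝ᵥ (P *ᵥ b)) • x s) (sub_mem_tangentCone (ϑ := θhat s) hθ)
    have e1 : ∑ i, 2 * ((θhat s i - θ i) * g s i)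
        = 2 * Γc * (Proj Ω (θhat s) (((xhat s - x s) ⬝ᵥ (P *ᵥ b)) • x s) ⬝ᵥ (θhat s - θ)) := by
      simp only [hg, dotProduct, Finset.mul_sum, Pi.smul_apply, Pi.sub_apply, smul_eq_mul]
      exact Finset.sum_congr rfl fun i _ => by ring
    rw [e1]
    rw [← neg_sub (θhat s) θ, dotProduct_neg, sub_dotProduct, smul_dotProduct, smul_eq_mul,
      dotProduct_comm (x s)] at hvar
    nlinarith

/-- The Lyapunov estimate. -/
theorem lyapunov_le (H : IsClosedLoop A b c K P Γc C Ω θ x₀ θhat₀ r x xhat θhat u u₂ y)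
    (hPs : Pᵀ = P) (hP : (closedMatrix A b K)ᵀ * P + P * closedMatrix A b K = -Q) (hΓc : 0 < Γc)
    (hΩc : Convex ℝ Ω) (hθ : θ ∈ Ω) {t : ℝ} (ht : 0 ≤ t) :
    (xhat t - x t) ⬝ᵥ (P *ᵥ (xhat t - x t)) + ∫ τ in (0 : ℝ)..t,
      (xhat τ - x τ) ⬝ᵥ (Q *ᵥ (xhat τ - x τ)) ≤ (θhat₀ - θ) ⬝ᵥ (θhat₀ - θ) / Γc := by
  rw [H.integral_error_energy hPs hP ht, le_div_iff₀ hΓc]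
  have h1 := H.estimate_sub_sq_le hΓc hΩc hθ ht
  have h2 : 0 ≤ (θhat t - θ) ⬝ᵥ (θhat t - θ) := Finset.sum_nonneg fun i _ => mul_self_nonneg _
  linarith

end IsClosedLoop

/-! ### Barbalat's lemma and integrability of responses -/

theorem abs_dotProduct_le {n : ℕ} (θ v : Fin n → ℝ) : |θ ⬝ᵥ v| ≤ (∑ j, |θ j|) * ‖v‖ := by
  rw [dotProduct, Finset.sum_mul]
  refine (Finset.abs_sum_le_sum_abs _ _).trans (Finset.sum_le_sum fun j _ => ?_)
  rw [abs_mul]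
  exact mul_le_mul_of_nonneg_left (norm_le_pi_norm v j) (abs_nonneg _)

theorem integrableOn_Ioi_of_interval_bound {f : ℝ → ℝ} (hf : ContinuousOn f (Ici 0))
    (h0 : ∀ t, 0 ≤ t → 0 ≤ f t) {B : ℝ} (hB : ∀ t, 0 ≤ t → ∫ τ in (0 : ℝ)..t, f τ ≤ B) :
    IntegrableOn f (Ioi 0) := by
  refine integrableOn_Ioi_of_intervalIntegral_norm_bounded B 0 (b := fun t : ℝ => t) (l := atTop)
    (fun t => ?_) tendsto_id ?_
  · exact ((hf.mono Icc_subset_Ici_self).integrableOn_Icc (b := t)).mono_set Ioc_subset_Icc_self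
  · filter_upwards [eventually_ge_atTop 0] with t ht
    refine le_of_eq_of_le (intervalIntegral.integral_congr fun τ hτ => ?_) (hB t ht)
    rw [uIcc_of_le ht] at hτ
    exact Real.norm_of_nonneg (h0 τ hτ.1)

/-- Barbalat's lemma for a bounded square-integrable signal with bounded derivative. -/
theorem tendsto_zero_of_sq_integrable {φ φ' : ℝ → ℝ} {M M' : ℝ}
    (hd : ∀ t, 0 ≤ t → HasDerivWithinAt φ (φ' t) (Ici 0) t) (hc : ContinuousOn φ' (Ici 0))
    (hM : ∀ t, 0 ≤ t → |φ t| ≤ M) (hM' : ∀ t, 0 ≤ t → |φ' t| ≤ M')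
    (hi : IntegrableOn (fun t => φ t ^ 2) (Ioi 0)) : Tendsto φ atTop (𝓝 0) := by
  have hφc : ContinuousOn φ (Ioi 0) := fun t ht =>
    ((hd t (le_of_lt ht)).continuousWithinAt).mono Ioi_subset_Ici_self
  -- The cube `φ³` and its derivative `3 φ' φ²` are both integrable, being bounded multiples of
  -- `φ²`; this forces `φ³ → 0`.
  have h1 : IntegrableOn (fun t => φ t * φ t ^ 2) (Ioi 0) :=
    Integrable.bdd_mul (c := M) hi (hφc.aestronglyMeasurable measurableSet_Ioi)
      ((ae_restrict_mem measurableSet_Ioi).mono fun t ht => hM t (le_of_lt ht))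
  have h2 : IntegrableOn (fun t => φ' t * φ t ^ 2) (Ioi 0) :=
    Integrable.bdd_mul (c := M') hi
      ((hc.mono Ioi_subset_Ici_self).aestronglyMeasurable measurableSet_Ioi)
      ((ae_restrict_mem measurableSet_Ioi).mono fun t ht => hM' t (le_of_lt ht))
  have hder : ∀ t ∈ Ioi (0 : ℝ), HasDerivAt (fun t => φ t * φ t ^ 2) (3 * (φ' t * φ t ^ 2)) t := by
    intro t ht
    have h := (hd t (le_of_lt ht)).hasDerivAt (Ici_mem_nhds ht)
    refine (h.mul (h.pow 2)).congr_deriv ?_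
    simp only [Pi.pow_apply]
    push_cast
    ring
  have hlim := tendsto_zero_of_hasDerivAt_of_integrableOn_Ioi hder (h2.const_mul 3) h1
  rw [Metric.tendsto_nhds] at hlim ⊢
  intro ε hε
  filter_upwards [hlim (ε ^ 3) (by positivity)] with t ht
  rw [Real.dist_eq, sub_zero] at ht ⊢
  rw [← pow_succ', abs_pow] at ht
  exact lt_of_pow_lt_pow_left₀ 3 hε.le ht

/-- Provides the local integrability of `u₂` that variation of constants requires. The input is
truncated at `t`, which leaves the response on `[0, t]` unchanged. -/
theorem intervalIntegrable_causalConv {h w : ℝ → ℝ} (hh : IntegrableOn h (Ioi 0))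
    (hw : ContinuousOn w (Ici 0)) {t : ℝ} (ht : 0 ≤ t) :
    IntervalIntegrable (causalConv h w) volume 0 t := by
  have hwi : IntegrableOn (indicator (Ioc 0 t) w) (Ioi 0) := by
    refine Integrable.integrableOn ?_
    rw [integrable_indicator_iff measurableSet_Ioc]
    exact ((hw.mono Icc_subset_Ici_self).integrableOn_Icc).mono_set Ioc_subset_Icc_self
  have h1 := intervalIntegrable_of_integrableOn_Ioi (integrableOn_causalConv hh hwi) le_rfl ht
  refine h1.congr fun s hs => ?_
  rw [uIoc_of_le ht] at hs
  rw [causalConv, causalConv, intervalIntegral.integral_of_le hs.1.le,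
    intervalIntegral.integral_of_le hs.1.le]
  refine setIntegral_congr_fun measurableSet_Ioc fun τ hτ => ?_
  simp only [indicator_of_mem (show τ ∈ Ioc 0 t from ⟨hτ.1, hτ.2.trans hs.2⟩)]

theorem causalConv_sub_kernel {f g v : ℝ → ℝ} {t : ℝ} (ht : 0 ≤ t) (hf : IntegrableOn f (Ioi 0))
    (hg : IntegrableOn g (Ioi 0)) (hv : ContinuousOn v (Ici 0)) :
    causalConv (fun τ => f τ - g τ) v t = causalConv f v t - causalConv g v t := by
  simp only [causalConv, sub_mul]
  exact intervalIntegral.integral_sub (intervalIntegrable_kernel_mul hf hv le_rfl ht le_rfl)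
    (intervalIntegrable_kernel_mul hg hv le_rfl ht le_rfl)

/-! ### Small-gain theorem -/

section SmallGain

variable {n : ℕ} {θ : Fin n → ℝ} {g : Fin n → ℝ → ℝ} {x δ : ℝ → Fin n → ℝ}

theorem exists_uniform_gain (hgain : ∀ i, (∫ t in Ioi (0 : ℝ), |g i t|) * ∑ j, |θ j| < 1) :
    ∃ lam : ℝ, 0 ≤ lam ∧ lam < 1 ∧ ∀ i, (∫ t in Ioi (0 : ℝ), |g i t|) * ∑ j, |θ j| ≤ lam := by
  rcases isEmpty_or_nonempty (Fin n) with h | h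
  · exact ⟨0, le_rfl, one_pos, fun i => h.elim i⟩
  · obtain ⟨i₀, hi₀⟩ := Finite.exists_max fun i => (∫ t in Ioi (0 : ℝ), |g i t|) * ∑ j, |θ j|
    exact ⟨_, mul_nonneg (integral_nonneg fun _ => abs_nonneg _)
      (Finset.sum_nonneg fun _ _ => abs_nonneg _), hgain i₀, hi₀⟩

/-- The small-gain theorem: boundedness. -/
theorem bounded_of_small_gain (hg : ∀ i, IntegrableOn (g i) (Ioi 0))
    (hgain : ∀ i, (∫ t in Ioi (0 : ℝ), |g i t|) * ∑ j, |θ j| < 1) (hx : ContinuousOn x (Ici 0))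
    (heq : ∀ t, 0 ≤ t → ∀ i, x t i = causalConv (g i) (fun τ => θ ⬝ᵥ x τ) t + δ t i) {D : ℝ}
    (hD : ∀ t, 0 ≤ t → ‖δ t‖ ≤ D) : ∃ M, ∀ t, 0 ≤ t → ‖x t‖ ≤ M := by
  obtain ⟨lam, h0, h1, hlam⟩ := exists_uniform_gain hgain
  refine ⟨D / (1 - lam), fun T hT => ?_⟩
  -- At a maximum point `s` of `‖x‖` on `[0, T]`, causality gives `‖x s‖ ≤ lam * ‖x s‖ + D`, a bound
  -- independent of `T`.
  obtain ⟨s, hs, hmax⟩ := isCompact_Icc.exists_isMaxOn ⟨T, hT, le_rfl⟩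
    ((hx.mono Icc_subset_Ici_self).norm (s := Icc 0 T))
  have hmax' : ∀ τ ∈ Icc 0 T, ‖x τ‖ ≤ ‖x s‖ := fun τ hτ => hmax hτ
  have hS : 0 ≤ ∑ j, |θ j| := Finset.sum_nonneg fun _ _ => abs_nonneg _
  have hbound : ‖x s‖ ≤ lam * ‖x s‖ + D := by
    refine (pi_norm_le_iff_of_nonneg ?_).2 fun i => ?_
    · exact add_nonneg (mul_nonneg h0 (norm_nonneg _)) ((norm_nonneg _).trans (hD 0 le_rfl))
    rw [heq s hs.1 i, Real.norm_eq_abs]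
    refine (abs_add_le _ _).trans (add_le_add ?_ ((norm_le_pi_norm (δ s) i).trans (hD s hs.1)))
    have h2 := abs_causalConv_le (v := fun τ => θ ⬝ᵥ x τ) (hg i) hs.1
      (mul_nonneg hS (norm_nonneg (x s))) fun τ hτ =>
        (abs_dotProduct_le θ (x τ)).trans
          (mul_le_mul_of_nonneg_left (hmax' τ ⟨hτ.1.le, hτ.2.trans hs.2⟩) hS)
    rw [← mul_assoc] at h2
    exact h2.trans (mul_le_mul_of_nonneg_right (hlam i) (norm_nonneg _))
  refine (hmax' T ⟨hT, le_rfl⟩).trans ((le_div_iff₀ (by linarith)).2 ?_)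
  linarith

/-- The small-gain theorem: convergence. -/
theorem tendsto_of_small_gain (hg : ∀ i, IntegrableOn (g i) (Ioi 0))
    (hg0 : ∀ i, ∫ t in Ioi (0 : ℝ), g i t = 0)
    (hgain : ∀ i, (∫ t in Ioi (0 : ℝ), |g i t|) * ∑ j, |θ j| < 1) (hx : ContinuousOn x (Ici 0))
    (heq : ∀ t, 0 ≤ t → ∀ i, x t i = causalConv (g i) (fun τ => θ ⬝ᵥ x τ) t + δ t i) {M : ℝ}
    (hM : ∀ t, 0 ≤ t → ‖x t‖ ≤ M) {xs : Fin n → ℝ} (hδ : Tendsto δ atTop (𝓝 xs)) :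
    Tendsto x atTop (𝓝 xs) := by
  obtain ⟨lam, h0, h1, hlam⟩ := exists_uniform_gain hgain
  have hS : 0 ≤ ∑ j, |θ j| := Finset.sum_nonneg fun _ _ => abs_nonneg _
  have hpc : ContinuousOn (fun τ => θ ⬝ᵥ (x τ - xs)) (Ici 0) :=
    (by fun_prop : Continuous fun v : Fin n → ℝ => θ ⬝ᵥ (v - xs)).comp_continuousOn hx
  have hzb : ∀ t, 0 ≤ t → ‖x t - xs‖ ≤ M + ‖xs‖ := fun t ht =>
    (norm_sub_le _ _).trans (add_le_add_left (hM t ht) _)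
  -- Centre the equation at the candidate limit. The extra response to the constant `θᵀ xs` vanishes
  -- asymptotically because the kernel has integral zero.
  have hz : ∀ t, 0 ≤ t → ∀ i, x t i - xs i = causalConv (g i) (fun τ => θ ⬝ᵥ (x τ - xs)) t
      + (causalConv (g i) (fun _ => θ ⬝ᵥ xs) t + (δ t i - xs i)) := by
    intro t ht i
    have h2 := causalConv_add (t := t)
      (intervalIntegrable_kernel_mul (hg i) hpc le_rfl ht le_rfl)
      (intervalIntegrable_kernel_mul (v := fun _ => θ ⬝ᵥ xs) (hg i) continuousOn_const le_rfl ht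
        le_rfl)
    simp only [dotProduct_sub, sub_add_cancel] at h2
    rw [heq t ht i, h2]
    simp only [dotProduct_sub]
    ring
  have hrest : ∀ i, Tendsto (fun t => causalConv (g i) (fun _ => θ ⬝ᵥ xs) t + (δ t i - xs i))
      atTop (𝓝 0) := by
    intro i
    have h2 := tendsto_causalConv_const (hg i) (θ ⬝ᵥ xs)
    rw [hg0 i, zero_mul] at h2
    have h3 := (tendsto_pi_nhds.1 hδ i).sub_const (xs i)
    rw [sub_self] at h3
    simpa using h2.add h3
  have key : Tendsto (fun t => ‖x t - xs‖) atTop (𝓝 0) := by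
    refine tendsto_zero_of_eventual_contraction h0 h1 ⟨M + ‖xs‖, ?_⟩ fun B hB0 hB ε hε => ?_
    · filter_upwards [eventually_ge_atTop 0] with t ht
      rw [abs_norm]
      exact hzb t ht
    · have hev : ∀ i, ∀ᶠ t in atTop, |x t i - xs i| ≤ lam * B + ε := by
        intro i
        have hpB : ∀ᶠ τ in atTop, |θ ⬝ᵥ (x τ - xs)| ≤ (∑ j, |θ j|) * B := by
          filter_upwards [hB] with τ hτ
          rw [abs_norm] at hτ
          exact (abs_dotProduct_le θ _).trans (mul_le_mul_of_nonneg_left hτ hS)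
        have h2 := eventually_abs_causalConv_le (hg i) hpc (M := (∑ j, |θ j|) * (M + ‖xs‖))
          (fun τ hτ => (abs_dotProduct_le θ _).trans (mul_le_mul_of_nonneg_left (hzb τ hτ) hS))
          (mul_nonneg hS hB0) hpB (half_pos hε)
        filter_upwards [eventually_ge_atTop 0, h2, Metric.tendsto_nhds.1 (hrest i) _ (half_pos hε)]
          with t ht h3 h4
        rw [Real.dist_eq, sub_zero] at h4
        rw [hz t ht i]
        have h5 := mul_le_mul_of_nonneg_right (hlam i) hB0
        have h6 := abs_add_le (causalConv (g i) (fun τ => θ ⬝ᵥ (x τ - xs)) t)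
          (causalConv (g i) (fun _ => θ ⬝ᵥ xs) t + (δ t i - xs i))
        rw [← mul_assoc] at h3
        linarith
      filter_upwards [eventually_all.2 hev] with t ht
      rw [abs_norm]
      refine (pi_norm_le_iff_of_nonneg ?_).2 ht
      exact add_nonneg (mul_nonneg h0 hB0) hε.le
  exact tendsto_iff_norm_sub_tendsto_zero.2 key

end SmallGain

/-! ### The loop as a perturbed feedback, and its prediction error -/

namespace IsClosedLoop

variable {n : ℕ} {A : Matrix (Fin n) (Fin n) ℝ} {b c K : Fin n → ℝ}
  {P Q : Matrix (Fin n) (Fin n) ℝ} {Γc : ℝ} {C : ℂ → ℂ} {Ω : Set (Fin n → ℝ)}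
  {θ x₀ θhat₀ : Fin n → ℝ} {x xhat θhat : ℝ → Fin n → ℝ} {u u₂ y : ℝ → ℝ}

/-- The prediction error is the response of `-H_o` to the parametric mismatch. -/
theorem causalConv_mismatch {r : ℝ → ℝ}
    (H : IsClosedLoop A b c K P Γc C Ω θ x₀ θhat₀ r x xhat θhat u u₂ y) {t : ℝ} (ht : 0 ≤ t)
    (i : Fin n) :
    causalConv (fun s => (transition (closedMatrix A b K) s *ᵥ b) i)
      (fun τ => (θhat τ - θ) ⬝ᵥ x τ) t = -(xhat t - x t) i := by
  have hc2 : Continuous fun p : (Fin n → ℝ) × (Fin n → ℝ) => p.1 ⬝ᵥ p.2 := by fun_prop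
  have hi : IntervalIntegrable (fun τ => -((θhat τ - θ) ⬝ᵥ x τ)) volume 0 t := by
    refine ContinuousOn.intervalIntegrable ?_
    rw [uIcc_of_le ht]
    exact ((hc2.comp_continuousOn ((H.continuousOn_estimate.sub continuousOn_const).prodMk
      H.continuousOn_state)).neg).mono Icc_subset_Ici_self
  have h := variation_of_constants (fun t ht => H.hasDerivWithinAt_error ht) ht hi i
  rw [causalConv_neg, H.plant_init, H.predictor_init, sub_self, Matrix.mulVec_zero] at h
  rw [h, Pi.zero_apply]
  ring

/-- The state as the response of `Ḡ` to `θᵀ x`, up to terms that converge. -/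
theorem state_eq {r : ℝ} {h : ℝ → ℝ} (hA : IsHurwitz (closedMatrix A b K))
    (H : IsClosedLoop A b c K P Γc C Ω θ x₀ θhat₀ (fun _ => r) x xhat θhat u u₂ y)
    (hh : IntegrableOn h (Ioi 0))
    (hu₂ : ∀ t, 0 ≤ t → u₂ t
      = causalConv h (fun τ => θhat τ ⬝ᵥ x τ + kg (closedMatrix A b K) b c * r) t)
    {t : ℝ} (ht : 0 ≤ t) (i : Fin n) :
    x t i = causalConv (fun s => causalConv (fun s => (transition (closedMatrix A b K) s *ᵥ b) i) h s
        - (transition (closedMatrix A b K) s *ᵥ b) i) (fun τ => θ ⬝ᵥ x τ) t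
      + ((transition (closedMatrix A b K) t *ᵥ x₀) i
        + causalConv (causalConv (fun s => (transition (closedMatrix A b K) s *ᵥ b) i) h)
            (fun _ => kg (closedMatrix A b K) b c * r) t
        - causalConv h (fun τ => (xhat τ - x τ) i) t) := by
  set ho : ℝ → ℝ := fun s => (transition (closedMatrix A b K) s *ᵥ b) i with hho
  set q : ℝ := kg (closedMatrix A b K) b c * r
  have hoi : IntegrableOn ho (Ioi 0) := integrableOn_transition_mulVec hA b i
  have hfi : IntegrableOn (causalConv ho h) (Ioi 0) := integrableOn_causalConv hoi hh
  have hc2 : Continuous fun p : (Fin n → ℝ) × (Fin n → ℝ) => p.1 ⬝ᵥ p.2 := by fun_prop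
  have hxc := H.continuousOn_state
  have hpc : ContinuousOn (fun τ => θ ⬝ᵥ x τ) (Ici 0) :=
    hc2.comp_continuousOn (continuousOn_const.prodMk hxc)
  have hηc : ContinuousOn (fun τ => (θhat τ - θ) ⬝ᵥ x τ) (Ici 0) :=
    hc2.comp_continuousOn ((H.continuousOn_estimate.sub continuousOn_const).prodMk hxc)
  have hpq : ContinuousOn (fun τ => θ ⬝ᵥ x τ + q) (Ici 0) := hpc.add continuousOn_const
  have hwc : ContinuousOn (fun τ => (θ ⬝ᵥ x τ + q) + (θhat τ - θ) ⬝ᵥ x τ) (Ici 0) := hpq.add hηc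
  -- Split the filter input into the true parameter part, the reference and the mismatch.
  have hw : (fun τ => θhat τ ⬝ᵥ x τ + q) = fun τ => (θ ⬝ᵥ x τ + q) + (θhat τ - θ) ⬝ᵥ x τ := by
    ext τ
    rw [sub_dotProduct]
    ring
  rw [hw] at hu₂
  have hu₂i : IntervalIntegrable u₂ volume 0 t := by
    refine (intervalIntegrable_causalConv hh hwc ht).congr fun s hs => ?_
    rw [uIoc_of_le ht] at hs
    exact (hu₂ s hs.1.le).symm
  have hpi : IntervalIntegrable (fun τ => θ ⬝ᵥ x τ) volume 0 t := by
    refine ContinuousOn.intervalIntegrable ?_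
    rw [uIcc_of_le ht]
    exact hpc.mono Icc_subset_Ici_self
  have hoc : Continuous ho := continuous_iff_continuousAt.2 fun s =>
    (hasDerivAt_pi.1 (hasDerivAt_transition_mulVec _ b s) i).continuousAt
  have hoc' : ContinuousOn (fun τ => ho (t - τ)) (uIcc 0 t) :=
    (hoc.comp (continuous_const.sub continuous_id)).continuousOn
  have hvoc := variation_of_constants (fun t ht => H.hasDerivWithinAt_state ht) ht
    (hu₂i.sub hpi) i
  rw [← hho, H.plant_init] at hvoc
  have s1 := causalConv_sub (h := ho) (hu₂i.continuousOn_mul hoc') (hpi.continuousOn_mul hoc')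
  have s2 : causalConv ho u₂ t
      = causalConv (causalConv ho h) (fun τ => (θ ⬝ᵥ x τ + q) + (θhat τ - θ) ⬝ᵥ x τ) t := by
    rw [causalConv_assoc hoi hh hwc ht]
    exact causalConv_congr ht fun τ hτ => hu₂ τ hτ.1
  have k := fun {v : ℝ → ℝ} (hv : ContinuousOn v (Ici 0)) =>
    intervalIntegrable_kernel_mul hfi hv le_rfl ht le_rfl
  have s3 := causalConv_add (k hpq) (k hηc)
  have s4 := causalConv_add (k hpc) (k (v := fun _ => q) continuousOn_const)
  -- Swapping the filter with `H_o` turns the mismatch, not yet known to be bounded, into the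
  -- filtered prediction error, which is.
  have s5 : causalConv (causalConv ho h) (fun τ => (θhat τ - θ) ⬝ᵥ x τ) t
      = - causalConv h (fun τ => (xhat τ - x τ) i) t := by
    rw [show causalConv ho h = causalConv h ho from funext (causalConv_comm ho h),
      causalConv_assoc hh hoi hηc ht, ← causalConv_neg]
    exact causalConv_congr ht fun τ hτ => H.causalConv_mismatch hτ.1 i
  have s6 := causalConv_sub_kernel ht hfi hoi hpc
  rw [s6, hvoc]
  change _ + causalConv ho (fun τ => u₂ τ - θ ⬝ᵥ x τ) t = _
  rw [s1, s2, s3, s4, s5]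
  ring

end IsClosedLoop

namespace IsClosedLoop

variable {n : ℕ} {A : Matrix (Fin n) (Fin n) ℝ} {b c K : Fin n → ℝ}
  {P Q : Matrix (Fin n) (Fin n) ℝ} {Γc : ℝ} {C : ℂ → ℂ} {Ω : Set (Fin n → ℝ)}
  {θ x₀ θhat₀ : Fin n → ℝ} {r : ℝ → ℝ} {x xhat θhat : ℝ → Fin n → ℝ} {u u₂ y : ℝ → ℝ}

/-- The prediction error is bounded and square-integrable. -/
theorem error_bounds (H : IsClosedLoop A b c K P Γc C Ω θ x₀ θhat₀ r x xhat θhat u u₂ y)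
    (hA : IsHurwitz (closedMatrix A b K)) (hQ : Q.PosDef)
    (hP : (closedMatrix A b K)ᵀ * P + P * closedMatrix A b K = -Q) (hΓc : 0 < Γc)
    (hΩc : Convex ℝ Ω) (hθ : θ ∈ Ω) :
    (∃ M, ∀ t, 0 ≤ t → ‖xhat t - x t‖ ≤ M) ∧
      ∀ i, IntegrableOn (fun t => ((xhat t - x t) i) ^ 2) (Ioi 0) := by
  have hQs : Qᵀ = Q := by simpa [Matrix.IsHermitian] using hQ.isHermitian
  have hQp : ∀ v : Fin n → ℝ, v ≠ 0 → 0 < v ⬝ᵥ (Q *ᵥ v) := fun v hv => by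
    simpa using hQ.dotProduct_mulVec_pos hv
  have hPs := transpose_eq_of_lyapunov hA hQs hP
  obtain ⟨κ, hκ, hPκ⟩ := exists_pos_mul_norm_sq_le fun v hv => lyapunov_pos hA hQp hP (v := v) hv
  obtain ⟨ρ, hρ, hQρ⟩ := exists_pos_mul_norm_sq_le hQp
  have hV := fun t (ht : 0 ≤ t) => H.lyapunov_le hPs hP hΓc hΩc hθ ht
  set V := (θhat₀ - θ) ⬝ᵥ (θhat₀ - θ) / Γc
  have hQ0 : ∀ v : Fin n → ℝ, 0 ≤ v ⬝ᵥ (Q *ᵥ v) := fun v => le_trans (by positivity) (hQρ v)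
  have hP0 : ∀ v : Fin n → ℝ, 0 ≤ v ⬝ᵥ (P *ᵥ v) := fun v => le_trans (by positivity) (hPκ v)
  have hQc : Continuous fun v : Fin n → ℝ => v ⬝ᵥ (Q *ᵥ v) := by fun_prop
  refine ⟨⟨√(V / κ), fun t ht => Real.le_sqrt_of_sq_le ?_⟩, fun i => ?_⟩
  · rw [le_div_iff₀ hκ, mul_comm]
    have h1 : 0 ≤ ∫ τ in (0 : ℝ)..t, (xhat τ - x τ) ⬝ᵥ (Q *ᵥ (xhat τ - x τ)) :=
      intervalIntegral.integral_nonneg ht fun τ _ => hQ0 _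
    linarith [hPκ (xhat t - x t), hV t ht]
  · have hint : IntegrableOn (fun t => (xhat t - x t) ⬝ᵥ (Q *ᵥ (xhat t - x t))) (Ioi 0) :=
      integrableOn_Ioi_of_interval_bound (hQc.comp_continuousOn H.continuousOn_error)
        (fun t _ => hQ0 _) (B := V) fun t ht => by linarith [hP0 (xhat t - x t), hV t ht]
    have hec : ContinuousOn (fun t => ((xhat t - x t) i) ^ 2) (Ioi 0) :=
      (((continuous_apply i).comp_continuousOn H.continuousOn_error).pow 2).mono Ioi_subset_Ici_self
    refine (hint.const_mul ρ⁻¹).mono' (hec.aestronglyMeasurable measurableSet_Ioi)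
      (Eventually.of_forall fun t => ?_)
    rw [Real.norm_of_nonneg (sq_nonneg _), inv_mul_eq_div, le_div_iff₀ hρ, mul_comm]
    refine le_trans (mul_le_mul_of_nonneg_left ?_ hρ.le) (hQρ (xhat t - x t))
    rw [← sq_abs]
    exact pow_le_pow_left₀ (abs_nonneg _) (norm_le_pi_norm (xhat t - x t) i) 2

/-- If the state is bounded, then the prediction error tends to zero. -/
theorem tendsto_error (H : IsClosedLoop A b c K P Γc C Ω θ x₀ θhat₀ r x xhat θhat u u₂ y)
    (hΓc : 0 < Γc) (hΩ : IsCompact Ω) (hΩc : Convex ℝ Ω) (hθhat₀ : θhat₀ ∈ Ω) {M M' : ℝ}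
    (hx : ∀ t, 0 ≤ t → ‖x t‖ ≤ M) (he : ∀ t, 0 ≤ t → ‖xhat t - x t‖ ≤ M') {i : Fin n}
    (hi : IntegrableOn (fun t => ((xhat t - x t) i) ^ 2) (Ioi 0)) :
    Tendsto (fun t => (xhat t - x t) i) atTop (𝓝 0) := by
  -- The error derivative is a continuous function of `(x̃, θ̂, x)`, and this triple stays in a
  -- compact set, so the derivative is bounded.
  set F : (Fin n → ℝ) × (Fin n → ℝ) × (Fin n → ℝ) → ℝ := fun p =>
    (closedMatrix A b K *ᵥ p.1 + (-((p.2.1 - θ) ⬝ᵥ p.2.2)) • b) i with hF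
  have hFc : Continuous F := by fun_prop
  obtain ⟨B, hB⟩ := ((isCompact_closedBall (0 : Fin n → ℝ) M').prod
    (hΩ.prod (isCompact_closedBall (0 : Fin n → ℝ) M))).exists_bound_of_continuousOn
    hFc.continuousOn
  refine tendsto_zero_of_sq_integrable (φ' := fun t => F (xhat t - x t, θhat t, x t)) (M := M')
    (M' := B) (fun t ht => hasDerivWithinAt_pi.1 (H.hasDerivWithinAt_error ht) i)
    (hFc.comp_continuousOn (H.continuousOn_error.prodMk
      (H.continuousOn_estimate.prodMk H.continuousOn_state)))
    (fun t ht => (norm_le_pi_norm (xhat t - x t) i).trans (he t ht)) (fun t ht => hB _ ?_) hi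
  exact ⟨mem_closedBall_zero_iff.2 (he t ht), H.estimate_mem hΓc hΩ hΩc hθhat₀ ht,
    mem_closedBall_zero_iff.2 (hx t ht)⟩

end IsClosedLoop

end L1Adaptive

/-! ### Assembly of the tracking limit -/

theorem mainTheorem11 {n : ℕ}
    (A : Matrix (Fin n) (Fin n) ℝ) (b c K : Fin n → ℝ)
    (hAm : L1Adaptive.IsHurwitz (L1Adaptive.closedMatrix A b K))
    (hkg : c ⬝ᵥ L1Adaptive.Ho ℝ (L1Adaptive.closedMatrix A b K) b 0 ≠ 0)
    (P Q : Matrix (Fin n) (Fin n) ℝ) (hQ : Q.PosDef)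
    (hP : (L1Adaptive.closedMatrix A b K)ᵀ * P + P * L1Adaptive.closedMatrix A b K = -Q)
    (Γc : ℝ) (hΓc : 0 < Γc)
    (C : ℂ → ℂ) (hC : L1Adaptive.IsStableStrictlyProper C) (hC0 : C 0 = 1)
    (Ω : Set (Fin n → ℝ)) (hΩ : IsCompact Ω) (hΩc : Convex ℝ Ω)
    (hgain : L1Adaptive.l1GainVec (L1Adaptive.Gbar (L1Adaptive.closedMatrix A b K) b C) *
      L1Adaptive.thetaMax Ω < 1)
    (θ : Fin n → ℝ) (hθ : θ ∈ Ω)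
    (x₀ θhat₀ : Fin n → ℝ) (hθhat₀ : θhat₀ ∈ Ω)
    (r : ℝ)
    (x xhat θhat : ℝ → Fin n → ℝ) (u u₂ y : ℝ → ℝ)
    (hloop : L1Adaptive.IsClosedLoop A b c K P Γc C Ω θ x₀ θhat₀ (fun _ => r)
      x xhat θhat u u₂ y) :
    Filter.Tendsto y Filter.atTop (nhds r) := by
  open L1Adaptive MeasureTheory Set Filter Topology in
  obtain ⟨h, hh, hu₂⟩ := hloop.filter
  set Am := closedMatrix A b K with hAmdef
  set q : ℝ := kg Am b c * r with hq
  set ho : Fin n → ℝ → ℝ := fun i s => (transition Am s *ᵥ b) i with hho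
  have hoI : ∀ i, IsImpulseResponse (ho i) (fun s => Ho ℂ Am b s i) := isImpulseResponse_Ho hAm b
  have hfI : ∀ i, IsImpulseResponse (causalConv (ho i) h) (fun s => Ho ℂ Am b s i * C s) :=
    fun i => (hoI i).causalConv hh
  set g : Fin n → ℝ → ℝ := fun i s => causalConv (ho i) h s - ho i s with hgdef
  have hgI : ∀ i, IsImpulseResponse (g i) (fun s => Gbar Am b C s i) := fun i => by
    have h1 := (hfI i).sub (hoI i)
    have e : (fun s => Ho ℂ Am b s i * C s - Ho ℂ Am b s i) = fun s => Gbar Am b C s i := by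
      ext s
      simp only [Gbar]
      ring
    rwa [e] at h1
  have hsmall := integral_abs_mul_sum_lt_one hgI hgain hθ
  -- The condition `C(0) = 1` gives `Ḡ` zero DC gain.
  have hg0 : ∀ i, ∫ t in Ioi (0 : ℝ), g i t = 0 := fun i => by
    have h1 := (hgI i).ofReal_integral
    simp only [Gbar, hC0, sub_self, mul_zero] at h1
    exact_mod_cast h1
  have hf0 : ∀ i, ∫ t in Ioi (0 : ℝ), causalConv (ho i) h t = Ho ℝ Am b 0 i := fun i => by
    have h1 := (hfI i).ofReal_integral
    simp only [hC0, mul_one, Ho_complex_zero hAm] at h1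
    exact_mod_cast h1
  obtain ⟨⟨M', hM'⟩, hsq⟩ := hloop.error_bounds hAm hQ hP hΓc hΩc hθ
  set δ : ℝ → Fin n → ℝ := fun t i => (transition Am t *ᵥ x₀) i
    + causalConv (causalConv (ho i) h) (fun _ => q) t
    - causalConv h (fun τ => (xhat τ - x τ) i) t with hδ
  have hstate : ∀ t, 0 ≤ t → ∀ i, x t i = causalConv (g i) (fun τ => θ ⬝ᵥ x τ) t + δ t i :=
    fun t ht i => hloop.state_eq hAm hh.1 hu₂ ht i
  have heM : ∀ i t, 0 ≤ t → |(xhat t - x t) i| ≤ M' := fun i t ht =>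
    (norm_le_pi_norm (xhat t - x t) i).trans (hM' t ht)
  have hM'0 : 0 ≤ M' := (norm_nonneg _).trans (hM' 0 le_rfl)
  -- Only boundedness of `δ` is available here: its convergence needs `x̃ → 0`, which in turn needs
  -- the bound on `x` obtained from this one.
  have hδb : ∀ i, ∃ D, ∀ t, 0 ≤ t → |δ t i| ≤ D := by
    intro i
    obtain ⟨E, α, hα, hE⟩ := exists_transition_bound hAm x₀
    refine ⟨|E| + (∫ τ in Ioi (0 : ℝ), |causalConv (ho i) h τ|) * |q|
      + (∫ τ in Ioi (0 : ℝ), |h τ|) * M', fun t ht => ?_⟩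
    have h1 : |(transition Am t *ᵥ x₀) i| ≤ |E| := by
      refine (hE t ht i).trans ((mul_le_mul_of_nonneg_right (le_abs_self E)
        (Real.exp_pos _).le).trans (mul_le_of_le_one_right (abs_nonneg _) ?_))
      rw [Real.exp_le_one_iff]
      nlinarith
    have h2 := abs_causalConv_le (v := fun _ => q) (hfI i).1 ht (abs_nonneg q) fun _ _ => le_rfl
    have h3 := abs_causalConv_le (v := fun τ => (xhat τ - x τ) i) hh.1 ht hM'0
      fun τ hτ => heM i τ hτ.1.le
    exact (abs_sub _ _).trans (add_le_add ((abs_add_le _ _).trans (add_le_add h1 h2)) h3)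
  choose D hD using hδb
  have hDn : ∀ t, 0 ≤ t → ‖δ t‖ ≤ ∑ i, |D i| := fun t ht =>
    (pi_norm_le_iff_of_nonneg (Finset.sum_nonneg fun _ _ => abs_nonneg _)).2 fun i =>
      ((hD i t ht).trans (le_abs_self _)).trans
        (Finset.single_le_sum (f := fun i => |D i|) (fun _ _ => abs_nonneg _) (Finset.mem_univ i))
  obtain ⟨M, hM⟩ := bounded_of_small_gain (fun i => (hgI i).1) hsmall hloop.continuousOn_state
    hstate hDn
  have hδlim : Tendsto δ atTop (𝓝 fun i => Ho ℝ Am b 0 i * q) := by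
    refine tendsto_pi_nhds.2 fun i => ?_
    have h1 := tendsto_pi_nhds.1 (tendsto_transition_mulVec hAm x₀) i
    have h2 := tendsto_causalConv_const (hfI i).1 q
    have h3 := tendsto_causalConv_zero hh.1
      ((continuous_apply i).comp_continuousOn hloop.continuousOn_error) (heM i)
      (hloop.tendsto_error hΓc hΩ hΩc hθhat₀ hM hM' (hsq i))
    have h4 := (h1.add h2).sub h3
    rw [hf0 i, Pi.zero_apply, zero_add, sub_zero] at h4
    exact h4
  have hxlim := tendsto_of_small_gain (fun i => (hgI i).1) hg0 hsmall hloop.continuousOn_state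
    hstate hM hδlim
  have hc : Continuous fun v : Fin n → ℝ => c ⬝ᵥ v := by fun_prop
  have hy := (hc.tendsto _).comp hxlim
  have e : c ⬝ᵥ (fun i => Ho ℝ Am b 0 i * q) = r := by
    have h1 : c ⬝ᵥ (fun i => Ho ℝ Am b 0 i * q) = (c ⬝ᵥ Ho ℝ Am b 0) * q := by
      simp only [dotProduct, Finset.sum_mul]
      exact Finset.sum_congr rfl fun i _ => by ring
    rw [h1, hq, kg, ← mul_assoc, mul_one_div_cancel hkg, one_mul]
  rw [e] at hy
  refine hy.congr' ?_
  filter_upwards [eventually_ge_atTop 0] with t ht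
  exact (hloop.output t ht).symm
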